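/- Let $k\ge 2$ be an integer. An ordered increasing $k$-tree of size $n$ is a graph on $k$ root nodes, labelled $0_1,\dots,0_k$ (all of value $0$) and forming a clique, and $n$ inserted nodes labelled $1,\dots,n$, such that for every inserted node $j$ the neighbours of $j$ with a smaller label (its parents) form a $k$-clique, together with a linear order, for each $k$-clique $K$, on the set of children of $K$ (the inserted nodes whose set of parents is $K$). The local clustering coefficient of a node $u$ of degree $d(u)\ge 2$ in a graph is the number of edges joining two neighbours of $u$, divided by $\binom{d(u)}{2}$; it is $0$ if $d(u)\le 1$. Let $\bar C_n$ be the local clustering coefficient of a node chosen uniformly at random among all $n+k$ nodes of a uniformly random ordered increasing $k$-tree of size $n$. Then, as $n\to\infty$, $\mathbb{E}(\bar C_n)\to c_k$, where $c_k$ is the sum of the convergent series $$c_k=\sum_{m\ge 0}\frac{(k+1)(k-1)}{k(m+1)(m+k)\binom{m+2+\frac1k}{m+1}}\Bigl(2-\frac{k-2}{m+k-1}\Bigr),$$ and $$c_k=(k+1)\Biggl(\frac1{k-1}+\frac3k\binom{k-4-\frac1k}{k-2}\sum_{\ell=1}^{k-2}\frac1{\ell^2\binom{\ell+3+\frac1k-k}{\ell}}+\frac3k\sum_{\ell=0}^{k-3}\frac{(-1)^\ell}{(\ell+1)(\ell-1-\frac1k)\binom{k-2}{\ell+1}}-\frac3k\binom{k-4-\frac1k}{k-2}\Psi'\bigl(4+\tfrac1k-k\bigr)\Biggr),$$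 where $\binom{x}{r}=x(x-1)\cdots(x-r+1)/r!$ for real $x$ and integer $r\ge0$, and $\Psi'$ is the derivative of $\Psi=(\ln\Gamma)'=\Gamma'/\Gamma$. In particular $c_2=23-\frac94\pi^2$. Moreover $c_k\to1$ as $k\to\infty$. -/

import Mathlib

open Filter Topology
open scoped BigOperators

/-- Nodes of a `k`-tree of size `n`: the root nodes `0₁, …, 0ₖ` (left summand) and the `n` inserted
nodes (right summand). -/
abbrev KTreeNode (k n : ℕ) : Type := Fin k ⊕ Fin n

/-- The label of a node: `0` for the root nodes and `1, …, n` for the inserted nodes. -/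
def KTreeNode.label {k n : ℕ} : KTreeNode k n → ℕ :=
  Sum.elim (fun _ => 0) (fun j => (j : ℕ) + 1)

/-- The parents of the inserted node `j`: its neighbours with a smaller label. -/
def KTreeNode.parents {k n : ℕ} (G : SimpleGraph (KTreeNode k n)) (j : Fin n) :
    Set (KTreeNode k n) :=
  {v | G.Adj (Sum.inr j) v ∧ KTreeNode.label v < KTreeNode.label (Sum.inr j : KTreeNode k n)}

/-- Ordered increasing `k`-trees of size `n`: a graph in which the root nodes form a clique and every
inserted node is attached to all the nodes of a `k`-clique of nodes with smaller labels, together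
with a linear order on the set of children of each `k`-clique. -/
@[ext]
structure OrderedIncreasingKTree (k n : ℕ) where
  /-- The underlying labelled graph. -/
  graph : SimpleGraph (KTreeNode k n)
  /-- The root nodes form a clique. -/
  root_clique : ∀ a b : Fin k, a ≠ b → graph.Adj (Sum.inl a) (Sum.inl b)
  /-- The parents of an inserted node form a clique. -/
  parents_clique : ∀ j : Fin n, graph.IsClique (KTreeNode.parents graph j)
  /-- Every inserted node has exactly `k` parents. -/
  parents_card : ∀ j : Fin n, (KTreeNode.parents graph j).ncard = k
  /-- `before i j`: the nodes `i` and `j` are children of the same clique, and `i` precedes `j`. -/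
  before : Fin n → Fin n → Prop
  before_siblings : ∀ i j, before i j → KTreeNode.parents graph i = KTreeNode.parents graph j
  before_irrefl : ∀ i, ¬ before i i
  before_trans : ∀ i j l, before i j → before j l → before i l
  before_total : ∀ i j, KTreeNode.parents graph i = KTreeNode.parents graph j → i ≠ j →
    before i j ∨ before j i

instance (k n : ℕ) : Finite (OrderedIncreasingKTree k n) :=
  Finite.of_injective
    (fun T => ((T.graph, T.before) : SimpleGraph (KTreeNode k n) × (Fin n → Fin n → Prop)))
    (fun _ _ h => OrderedIncreasingKTree.ext (congrArg Prod.fst h) (congrArg Prod.snd h))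

noncomputable instance (k n : ℕ) : Fintype (OrderedIncreasingKTree k n) := Fintype.ofFinite _

/-- The local clustering coefficient of the node `u` of the graph `G`: the number of edges between
neighbours of `u` divided by the number of pairs of neighbours (and `0` if the degree is `0` or `1`). -/
noncomputable def localClusteringCoeff {V : Type*} (G : SimpleGraph V) (u : V) : ℝ :=
  if 2 ≤ (G.neighborSet u).ncard then
    ({e ∈ G.edgeSet | ∀ v ∈ e, v ∈ G.neighborSet u}.ncard : ℝ) /
      ((G.neighborSet u).ncard.choose 2 : ℝ)
  else 0

/-- The expected local clustering coefficient of a node chosen uniformly at random among all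
`n + k` nodes of a uniformly random ordered increasing `k`-tree of size `n`. -/
noncomputable def expectedClustering (k n : ℕ) : ℝ :=
  𝔼 T : OrderedIncreasingKTree k n, 𝔼 u : KTreeNode k n, localClusteringCoeff T.graph u

/-- The `m`-th term of the series for `c_k`. -/
noncomputable def clusteringTerm (k m : ℕ) : ℝ :=
  (((k : ℝ) + 1) * ((k : ℝ) - 1)) /
      ((k : ℝ) * ((m : ℝ) + 1) * ((m : ℝ) + k) * Ring.choose ((m : ℝ) + 2 + 1 / (k : ℝ)) (m + 1)) *
    (2 - ((k : ℝ) - 2) / ((m : ℝ) + k - 1))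

/-- The constant `c_k`. -/
noncomputable def clusteringLimit (k : ℕ) : ℝ := ∑' m : ℕ, clusteringTerm k m

/-- The derivative `Ψ'` of the Psi-function `Ψ = (log Γ)' = Γ' / Γ` on the reals. -/
noncomputable def trigamma (x : ℝ) : ℝ := deriv (logDeriv Real.Gamma) x

/-- The closed form of `c_k`. -/
noncomputable def clusteringClosedForm (k : ℕ) : ℝ :=
  ((k : ℝ) + 1) *
    (1 / ((k : ℝ) - 1)
      + 3 / (k : ℝ) * Ring.choose ((k : ℝ) - 4 - 1 / (k : ℝ)) (k - 2) *
          ∑ l ∈ Finset.Icc 1 (k - 2),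
            1 / ((l : ℝ) ^ 2 * Ring.choose ((l : ℝ) + 3 + 1 / (k : ℝ) - k) l)
      + 3 / (k : ℝ) *
          ∑ l ∈ Finset.range (k - 2),
            (-1 : ℝ) ^ l /
              (((l : ℝ) + 1) * ((l : ℝ) - 1 - 1 / (k : ℝ)) * ((k - 2).choose (l + 1) : ℝ))
      - 3 / (k : ℝ) * Ring.choose ((k : ℝ) - 4 - 1 / (k : ℝ)) (k - 2) *
          trigamma (4 + 1 / (k : ℝ) - k))

/-!
A tree of size `n + 1` arises from exactly one tree of size `n` by adding the last node at a slot: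
either as the last child of a `k`-clique or directly before an existing inserted node, as its
sibling (`insertAt_injective`, `insertAt_surjective`). There are `(k + 1) n + 1` slots
(`card_slot`), since a tree has `k n + 1` cliques of size `k`; and an inserted node `u` which is a
parent of `m` nodes becomes a parent of the new node at `k (m + 1)` of them
(`sum_slot_mem_parents`). The number `m` determines the local clustering coefficient of `u`,
namely `(k - 1) (k + 2 m) / ((k + m) (k + m - 1))` (`localClusteringCoeff_inr`): among the `k + m`
neighbours, the `k` parents form a clique, and each of the `m` others is adjacent to `k - 1`
neighbours of `u` with a smaller label than its own.

The expected number of inserted nodes with a given `m` therefore satisfies a linear recurrence in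
`n`, and its quotient by `n` converges to `(k + 1) / k * B(m + 1, 2 + 1 / k)`
(`tendsto_expectedCount_div`). Because the clustering coefficient tends to zero as `m` grows, the
mean clustering coefficient converges to the sum over `m`
(`tendsto_expectedNodeSum_nodeClustering`), and the `k` root nodes contribute nothing in the
limit. The terms of the series are at most `2 / ((m + 1) (m + 2))` and converge to `1 / ((m + 1)
(m + 2))` as `k → ∞`, so that dominated convergence gives the limit of the constants
(`tendsto_clusteringLimit`).

For the closed form, partial fractions express the series through the sums `S r = ∑ B(m + 1, z) /
(m + r + 1)` with `z = 2 + 1 / k` and `r = k - 2`, `r = k - 1`. They satisfy a first-order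
recurrence in `r` (`betaSeries_succ`), which first eliminates `S (k - 1)` and then reduces `S (k -
2)` to `S 0 = Ψ' z` (`trigamma_eq_betaSeries`). The closed form satisfies the same recurrence, by
the functional equation of `Ψ'` and two telescoping alternating sums of reciprocal binomial
coefficients (`betaSeries_eq_closedForm`). That `Ψ' x = ∑ 1 / (x + n) ^ 2` for `x > 0` is a
consequence of the functional equation and the log-convexity of `Γ` (`hasDerivAt_logDeriv_Gamma`).
-/

/-! ### The digamma function on the reals -/

theorem logDeriv_Gamma_add_one {x : ℝ} (hx : ∀ m : ℕ, x ≠ -m) :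
    logDeriv Real.Gamma (x + 1) = logDeriv Real.Gamma x + 1 / x := by
  have hx0 : x ≠ 0 := by simpa using hx 0
  have hG : Real.Gamma x ≠ 0 := Real.Gamma_ne_zero hx
  have h1 : deriv Real.Gamma (x + 1) = Real.Gamma x + x * deriv Real.Gamma x := by
    rw [← deriv_comp_add_const]
    have : (fun t : ℝ => Real.Gamma (t + 1)) =ᶠ[𝓝 x] fun t => t * Real.Gamma t := by
      filter_upwards [eventually_ne_nhds hx0] with t ht using Real.Gamma_add_one ht
    rw [this.deriv_eq]
    simpa using ((hasDerivAt_id' x).fun_mul (Real.differentiableAt_Gamma hx).hasDerivAt).deriv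
  rw [logDeriv_apply, logDeriv_apply, h1, Real.Gamma_add_one hx0]
  field_simp
  ring

theorem ne_neg_natCast_of_pos {x : ℝ} (hx : 0 < x) (m : ℕ) : x ≠ -m := by
  have : (0 : ℝ) ≤ m := m.cast_nonneg
  exact ne_of_gt (by linarith)

theorem logDeriv_Gamma_add_nat {x : ℝ} (hx : 0 < x) (n : ℕ) :
    logDeriv Real.Gamma (x + n) =
      logDeriv Real.Gamma x + ∑ i ∈ Finset.range n, 1 / (x + i) := by
  induction n with
  | zero => simp
  | succ n ih =>
    rw [Nat.cast_succ, ← add_assoc,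
      logDeriv_Gamma_add_one (ne_neg_natCast_of_pos (by positivity)), ih,
      Finset.sum_range_succ, add_assoc]

/-- The digamma function is increasing on `(0, ∞)`, because `log Γ` is convex there. -/
theorem monotoneOn_logDeriv_Gamma : MonotoneOn (logDeriv Real.Gamma) (Set.Ioi 0) := by
  have hd : ∀ x ∈ Set.Ioi (0 : ℝ), DifferentiableAt ℝ (Real.log ∘ Real.Gamma) x := fun x hx =>
    (Real.differentiableAt_Gamma (ne_neg_natCast_of_pos hx)).log
      (Real.Gamma_ne_zero (ne_neg_natCast_of_pos hx))
  refine (Real.convexOn_log_Gamma.monotoneOn_deriv hd).congr fun x hx => ?_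
  have := deriv.log (Real.differentiableAt_Gamma (ne_neg_natCast_of_pos hx))
    (Real.Gamma_ne_zero (ne_neg_natCast_of_pos hx))
  rw [logDeriv_apply, ← this]
  rfl

/-- Differences of the digamma function as a series: by the functional equation the partial sums
differ from the claimed value by an increment `ψ(y + n) - ψ(x + n)`, which monotonicity bounds by
`ψ(x + n + M) - ψ(x + n) ≤ M / (x + n)` for a natural number `M ≥ y - x`. -/
theorem hasSum_logDeriv_Gamma_sub {x y : ℝ} (hx : 0 < x) (hxy : x ≤ y) :
    HasSum (fun n : ℕ => 1 / (x + n) - 1 / (y + n))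
      (logDeriv Real.Gamma y - logDeriv Real.Gamma x) := by
  have hy : 0 < y := hx.trans_le hxy
  rw [hasSum_iff_tendsto_nat_of_nonneg]
  swap
  · intro n
    rw [sub_nonneg]
    gcongr
  obtain ⟨M, hM⟩ := exists_nat_ge (y - x)
  have hrem : Tendsto (fun n : ℕ => logDeriv Real.Gamma (y + n) - logDeriv Real.Gamma (x + n))
      atTop (𝓝 0) := by
    refine squeeze_zero (g := fun n : ℕ => (M : ℝ) / (x + n)) (fun n => ?_) (fun n => ?_) ?_
    · rw [sub_nonneg]
      refine monotoneOn_logDeriv_Gamma ?_ ?_ (by linarith) <;> rw [Set.mem_Ioi] <;> positivity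
    · have h1 : logDeriv Real.Gamma (y + n) ≤ logDeriv Real.Gamma (x + n + M) := by
        refine monotoneOn_logDeriv_Gamma ?_ ?_ (by linarith) <;> rw [Set.mem_Ioi] <;> positivity
      rw [logDeriv_Gamma_add_nat (by positivity) M] at h1
      have h2 : ∑ i ∈ Finset.range M, 1 / (x + n + i) ≤ ∑ i ∈ Finset.range M, 1 / (x + n) := by
        refine Finset.sum_le_sum fun i _ => ?_
        have : (0 : ℝ) ≤ i := i.cast_nonneg
        have : 0 < x + n := by positivity
        exact one_div_le_one_div_of_le this (by linarith)
      rw [Finset.sum_const, Finset.card_range, nsmul_eq_mul, mul_one_div] at h2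
      linarith
    · exact Tendsto.div_atTop tendsto_const_nhds
        (tendsto_atTop_add_const_left _ _ tendsto_natCast_atTop_atTop)
  have := (tendsto_const_nhds (x := logDeriv Real.Gamma y - logDeriv Real.Gamma x)).sub hrem
  rw [sub_zero] at this
  refine this.congr fun n => ?_
  rw [logDeriv_Gamma_add_nat hx, logDeriv_Gamma_add_nat hy, Finset.sum_sub_distrib]
  ring

theorem summable_one_div_add_sq (x : ℝ) : Summable fun n : ℕ => 1 / (x + n) ^ 2 := by
  refine ((Real.summable_one_div_nat_add_rpow x 2).2 one_lt_two).congr fun n => ?_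
  rw [Real.rpow_two, sq_abs, add_comm]

/-- The digamma function has derivative `∑ 1 / (x + n) ^ 2` at every positive `x`. -/
theorem hasDerivAt_logDeriv_Gamma {x : ℝ} (hx : 0 < x) :
    HasDerivAt (logDeriv Real.Gamma) (∑' n : ℕ, 1 / (x + n) ^ 2) x := by
  have key : HasDerivAt (fun z => ∑' n : ℕ, (1 / (x + n) - 1 / (z + n)))
      (∑' n : ℕ, 1 / (x + n) ^ 2) x := by
    refine hasDerivAt_tsum_of_isPreconnected (t := Set.Ioi (x / 2))
      (g' := fun (n : ℕ) (y : ℝ) => 1 / (y + n) ^ 2)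
      (u := fun n : ℕ => 1 / (x / 2 + n) ^ 2) (y₀ := x)
      (summable_one_div_add_sq _) isOpen_Ioi isPreconnected_Ioi ?_ ?_ (Set.mem_Ioi.2 (by linarith))
      (by simp) (Set.mem_Ioi.2 (by linarith))
    · intro n y hy
      have hy : 0 < y := lt_trans (by positivity) hy
      have hne : y + n ≠ 0 := by positivity
      have h := (((hasDerivAt_id y).add_const (n : ℝ)).inv hne).const_sub (1 / (x + n))
      simpa [neg_div, one_div] using h
    · intro n y hy
      have hy : x / 2 < y := hy
      have : 0 < x / 2 := by positivity
      rw [Real.norm_of_nonneg (by positivity)]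
      gcongr
  refine (key.add_const (logDeriv Real.Gamma x)).congr_of_eventuallyEq ?_
  filter_upwards [eventually_gt_nhds hx] with y hy
  rcases le_total x y with h | h
  · rw [(hasSum_logDeriv_Gamma_sub hx h).tsum_eq]
    ring
  · have := (hasSum_logDeriv_Gamma_sub hy h).neg
    simp only [neg_sub] at this
    rw [this.tsum_eq]
    ring

theorem trigamma_of_pos {x : ℝ} (hx : 0 < x) : trigamma x = ∑' n : ℕ, 1 / (x + n) ^ 2 :=
  (hasDerivAt_logDeriv_Gamma hx).deriv

theorem hasDerivAt_logDeriv_Gamma_of_add_one {x d : ℝ} (hx : x ∉ Set.range ((↑) : ℤ → ℝ))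
    (h : HasDerivAt (logDeriv Real.Gamma) d (x + 1)) :
    HasDerivAt (logDeriv Real.Gamma) (d + 1 / x ^ 2) x := by
  have hopen : ∀ᶠ y in 𝓝 x, y ∉ Set.range ((↑) : ℤ → ℝ) :=
    Int.isClosedEmbedding_coe_real.isClosed_range.isOpen_compl.mem_nhds hx
  have hx0 : x ≠ 0 := fun h0 => hx ⟨0, by simp [h0]⟩
  have h1 : HasDerivAt (fun y => logDeriv Real.Gamma (y + 1) - y⁻¹) (d + 1 / x ^ 2) x := by
    have := (h.comp_add_const x 1).fun_sub (hasDerivAt_inv hx0)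
    simpa [sub_neg_eq_add, one_div] using this
  refine h1.congr_of_eventuallyEq ?_
  filter_upwards [hopen] with y hy
  rw [logDeriv_Gamma_add_one fun m hm => hy ⟨-m, by simp [hm]⟩]
  simp

theorem differentiableAt_logDeriv_Gamma_sub_nat {x : ℝ} (hx : 0 < x)
    (hx' : x ∉ Set.range ((↑) : ℤ → ℝ)) (n : ℕ) :
    DifferentiableAt ℝ (logDeriv Real.Gamma) (x - n) := by
  induction n with
  | zero => simpa using (hasDerivAt_logDeriv_Gamma hx).differentiableAt
  | succ n ih =>
    refine (hasDerivAt_logDeriv_Gamma_of_add_one (d := deriv (logDeriv Real.Gamma) (x - n))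
      ?_ ?_).differentiableAt
    · rintro ⟨z, hz⟩
      exact hx' ⟨z + (n + 1), by push_cast at hz ⊢; linarith⟩
    · rw [Nat.cast_succ, show x - (n + 1) + 1 = x - n by ring]
      exact ih.hasDerivAt

/-- The functional equation of the trigamma function at a noninteger argument, whatever its sign. -/
theorem trigamma_sub_nat_succ {x : ℝ} (hx : 0 < x) (hx' : x ∉ Set.range ((↑) : ℤ → ℝ)) (n : ℕ) :
    trigamma (x - (n + 1)) = trigamma (x - n) + 1 / (x - (n + 1)) ^ 2 := by
  refine (hasDerivAt_logDeriv_Gamma_of_add_one ?_ ?_).deriv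
  · rintro ⟨z, hz⟩
    exact hx' ⟨z + (n + 1), by push_cast; linarith⟩
  · rw [show x - (n + 1) + 1 = x - n by ring]
    exact (differentiableAt_logDeriv_Gamma_sub_nat hx hx' n).hasDerivAt

/-! ### Generalized binomial coefficients -/

theorem succ_mul_ringChoose_succ (x : ℝ) (i : ℕ) :
    ((i : ℝ) + 1) * Ring.choose x (i + 1) = (x - i) * Ring.choose x i := by
  have := Ring.choose_smul_choose x (Nat.le_succ i)
  simp only [Nat.succ_eq_add_one, Nat.choose_succ_self_right, add_tsub_cancel_left,
    Ring.choose_one_right, nsmul_eq_mul, Nat.cast_add, Nat.cast_one] at this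
  linarith

theorem succ_mul_ringChoose_succ' (x : ℝ) (i : ℕ) :
    ((i : ℝ) + 1) * Ring.choose x (i + 1) = x * Ring.choose (x - 1) i := by
  have := Ring.choose_smul_choose x (Nat.le_add_left 1 i)
  simpa [nsmul_eq_mul] using this

theorem sub_mul_ringChoose (x : ℝ) (i : ℕ) :
    (x - i) * Ring.choose x i = x * Ring.choose (x - 1) i := by
  rw [← succ_mul_ringChoose_succ, succ_mul_ringChoose_succ']

theorem ringChoose_ne_zero {x : ℝ} (hx : x ∉ Set.range ((↑) : ℤ → ℝ)) (i : ℕ) :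
    Ring.choose x i ≠ 0 := by
  induction i with
  | zero => simp
  | succ i ih =>
    have h := succ_mul_ringChoose_succ x i
    intro h0
    rw [h0, mul_zero, zero_eq_mul] at h
    rcases h with h | h
    · exact hx ⟨i, by push_cast; linarith⟩
    · exact ih h

theorem ringChoose_sub_one_sub (y : ℝ) (l : ℕ) :
    Ring.choose ((l : ℝ) - 1 - y) l = (-1) ^ l * Ring.choose y l := by
  rw [show (l : ℝ) - 1 - y = -(y - l + 1) by ring, Ring.choose_neg,
    show y - l + 1 + l - 1 = y by ring]
  rcases Nat.even_or_odd l with h | h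
  · rw [h.neg_one_pow, Int.negOnePow_even _ (by exact_mod_cast h)]
    simp
  · rw [h.neg_one_pow, Int.negOnePow_odd _ (by exact_mod_cast h)]
    simp

/-- Alternating sums of reciprocal binomial coefficients telescope, since
`(w + 2) / C(w, i) = (w + 1) (1 / C(w + 1, i) + 1 / C(w + 1, i + 1))`. -/
theorem sum_neg_one_pow_div_ringChoose {w : ℝ} (hw : w + 2 ≠ 0) (n : ℕ)
    (h : ∀ i ≤ n, Ring.choose (w + 1) i ≠ 0) :
    ∑ i ∈ Finset.range n, (-1 : ℝ) ^ i / Ring.choose w i =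
      (w + 1) / (w + 2) * (1 - (-1) ^ n / Ring.choose (w + 1) n) := by
  induction n with
  | zero => simp
  | succ n ih =>
    rw [Finset.sum_range_succ, ih fun i hi => h i (hi.trans n.le_succ)]
    have h0 := h n n.le_succ
    have h1 := h (n + 1) le_rfl
    have e1 := succ_mul_ringChoose_succ (w + 1) n
    have e2 := sub_mul_ringChoose (w + 1) n
    rw [add_sub_cancel_right] at e2
    have hn : (n : ℝ) + 1 ≠ 0 := by positivity
    have hwn : w + 1 - n ≠ 0 := fun h2 => mul_ne_zero hn h1 (by rw [e1, h2, zero_mul])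
    have hw1 : w + 1 ≠ 0 := fun h2 => mul_ne_zero hwn h0 (by rw [e2, h2, zero_mul])
    have e1' : Ring.choose (w + 1) (n + 1) = (w + 1 - n) * Ring.choose (w + 1) n / (n + 1) := by
      rw [← e1]; field_simp
    have e2' : Ring.choose w n = (w + 1 - n) * Ring.choose (w + 1) n / (w + 1) := by
      rw [e2]; field_simp
    rw [e1', e2', pow_succ]
    field_simp
    ring

/-! ### Series of beta values -/

/-- The beta value `B(m + 1, z) = m! / (z (z + 1) ⋯ (z + m))`. -/
noncomputable def betaTerm (z : ℝ) (m : ℕ) : ℝ :=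
  (m.factorial : ℝ) / ∏ i ∈ Finset.range (m + 1), (z + i)

theorem betaTerm_pos {z : ℝ} (hz : 0 < z) (m : ℕ) : 0 < betaTerm z m := by
  have : 0 < ∏ i ∈ Finset.range (m + 1), (z + i) := Finset.prod_pos fun i _ => by positivity
  unfold betaTerm
  positivity

theorem betaTerm_zero (z : ℝ) : betaTerm z 0 = 1 / z := by simp [betaTerm]

theorem betaTerm_succ {z : ℝ} (hz : 0 < z) (m : ℕ) :
    (z + m + 1) * betaTerm z (m + 1) = (m + 1) * betaTerm z m := by
  have : 0 < ∏ i ∈ Finset.range (m + 1), (z + i) := Finset.prod_pos fun i _ => by positivity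
  rw [betaTerm, betaTerm, Finset.prod_range_succ _ (m + 1), Nat.factorial_succ]
  push_cast
  field_simp
  ring

theorem betaTerm_succ' {z : ℝ} (hz : 0 < z) (m : ℕ) :
    z * betaTerm z (m + 1) = (m + 1) * betaTerm (z + 1) m := by
  have h : ∏ i ∈ Finset.range (m + 1), (z + 1 + i) =
      ∏ i ∈ Finset.range (m + 1), (z + (i + 1 : ℕ)) :=
    Finset.prod_congr rfl fun i _ => by push_cast; ring
  have : 0 < ∏ i ∈ Finset.range (m + 1), (z + (i + 1 : ℕ)) :=
    Finset.prod_pos fun i _ => by positivity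
  rw [betaTerm, betaTerm, Finset.prod_range_succ' _ (m + 1), Nat.factorial_succ, h]
  push_cast at this ⊢
  rw [add_zero]
  field_simp

theorem betaTerm_sub_betaTerm_add_one {z : ℝ} (hz : 0 < z) (m : ℕ) :
    betaTerm z m - betaTerm (z + 1) m = betaTerm z (m + 1) := by
  have h1 := betaTerm_succ hz m
  have h2 := betaTerm_succ' hz m
  have : (0 : ℝ) < m + 1 := by positivity
  refine mul_left_cancel₀ this.ne' ?_
  linarith

theorem betaTerm_le {z : ℝ} (hz : 2 ≤ z) (m : ℕ) :
    betaTerm z m ≤ 2 / z * (1 / ((m + 1) * (m + 2))) := by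
  have hz0 : 0 < z := by linarith
  induction m with
  | zero => rw [betaTerm_zero]; apply le_of_eq; field_simp; norm_num
  | succ m ih =>
    have h := betaTerm_succ hz0 m
    have h1 : betaTerm z (m + 1) = (m + 1) / (z + m + 1) * betaTerm z m := by
      field_simp
      linarith
    rw [h1]
    calc (m + 1) / (z + m + 1) * betaTerm z m
        ≤ (m + 1) / (2 + m + 1) * (2 / z * (1 / ((m + 1) * (m + 2)))) := by
          gcongr
          exact (betaTerm_pos hz0 m).le
      _ = 2 / z * (1 / (((m + 1 : ℕ) + 1) * ((m + 1 : ℕ) + 2))) := by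
          push_cast
          field_simp
          ring

theorem hasSum_one_div_add_one_mul_add_two :
    HasSum (fun m : ℕ => 1 / (((m : ℝ) + 1) * (m + 2))) 1 := by
  rw [hasSum_iff_tendsto_nat_of_nonneg fun m => by positivity]
  have h : ∀ n : ℕ, 1 - 1 / ((n : ℝ) + 1) =
      ∑ m ∈ Finset.range n, 1 / (((m : ℝ) + 1) * (m + 2)) := by
    intro n
    induction n with
    | zero => simp
    | succ n ih =>
      rw [Finset.sum_range_succ, ← ih]
      push_cast
      field_simp
      ring
  simp_rw [← h]
  simpa using (tendsto_const_nhds (x := (1 : ℝ))).sub tendsto_one_div_add_atTop_nhds_zero_nat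

theorem summable_betaTerm {z : ℝ} (hz : 2 ≤ z) : Summable (betaTerm z) :=
  Summable.of_nonneg_of_le (fun m => (betaTerm_pos (by linarith) m).le) (betaTerm_le hz)
    (hasSum_one_div_add_one_mul_add_two.summable.mul_left _)

theorem hasSum_betaTerm {z : ℝ} (hz : 2 ≤ z) : HasSum (betaTerm z) (1 / (z - 1)) := by
  have hz0 : 0 < z := by linarith
  have hz1 : 0 < z - 1 := by linarith
  rw [hasSum_iff_tendsto_nat_of_nonneg fun m => (betaTerm_pos hz0 m).le]
  have h : ∀ n : ℕ, 1 / (z - 1) * (1 - (z + n) * betaTerm z n) =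
      ∑ m ∈ Finset.range n, betaTerm z m := by
    intro n
    induction n with
    | zero => simp [betaTerm_zero, hz0.ne']
    | succ n ih =>
      rw [Finset.sum_range_succ, ← ih]
      have := betaTerm_succ hz0 n
      push_cast
      rw [← add_assoc, this]
      field_simp
      ring
  simp_rw [← h]
  have hlim : Tendsto (fun n : ℕ => (z + n) * betaTerm z n) atTop (𝓝 0) := by
    refine squeeze_zero (g := fun n : ℕ => 2 * (1 / ((n : ℝ) + 1)))
      (fun n => mul_nonneg (by positivity) (betaTerm_pos hz0 n).le) (fun n => ?_) ?_
    · calc (z + n) * betaTerm z n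
          ≤ (z + n) * (2 / z * (1 / ((n + 1) * (n + 2)))) := by
            gcongr
            exact betaTerm_le hz n
        _ = 2 * (1 / ((n : ℝ) + 1)) * ((z + n) / (z * (n + 2))) := by field_simp
        _ ≤ 2 * (1 / ((n : ℝ) + 1)) * 1 := by
            gcongr
            rw [div_le_one (by positivity)]
            have : (0 : ℝ) ≤ n := n.cast_nonneg
            nlinarith
        _ = _ := mul_one _
    · simpa using tendsto_one_div_add_atTop_nhds_zero_nat.const_mul (2 : ℝ)
  simpa using (hlim.const_sub 1).const_mul (1 / (z - 1))

theorem summable_betaTerm_div {z : ℝ} (hz : 2 ≤ z) (r : ℕ) :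
    Summable fun m : ℕ => betaTerm z m / ((m : ℝ) + (r + 1)) := by
  refine Summable.of_nonneg_of_le (fun m => ?_) (fun m => ?_) (summable_betaTerm hz)
  · exact div_nonneg (betaTerm_pos (by linarith) m).le (by positivity)
  · refine div_le_self (betaTerm_pos (by linarith) m).le ?_
    have : (0 : ℝ) ≤ (m : ℝ) + r := by positivity
    linarith

/-- The series `∑ B(m + 1, z) / (m + r + 1)`. -/
noncomputable def betaSeries (z : ℝ) (r : ℕ) : ℝ := ∑' m : ℕ, betaTerm z m / ((m : ℝ) + (r + 1))

/-- The first-order recurrence in `r`: sum `(m + z) B(m + 1, z) / (m + r + 1)` in two ways, using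
`(m + 1 + z) B(m + 2, z) = (m + 1) B(m + 1, z)`. -/
theorem betaSeries_succ {z : ℝ} (hz : 2 ≤ z) (r : ℕ) :
    ((r : ℝ) + 1) * betaSeries z (r + 1) = 1 / (r + 1) + (r + 1 - z) * betaSeries z r := by
  have hz0 : 0 < z := by linarith
  have h1 : HasSum (fun m : ℕ => betaTerm z m + (z - (r + 1)) * (betaTerm z m / (m + (r + 1))))
      (1 / (z - 1) + (z - (r + 1)) * betaSeries z r) :=
    (hasSum_betaTerm hz).add ((summable_betaTerm_div hz r).hasSum.mul_left _)
  have h2 : HasSum (fun m : ℕ => betaTerm z m -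
      (r + 1) * (betaTerm z m / (m + ((r + 1 : ℕ) + 1))))
      (1 / (z - 1) - (r + 1) * betaSeries z (r + 1)) :=
    (hasSum_betaTerm hz).sub ((summable_betaTerm_div hz (r + 1)).hasSum.mul_left _)
  have h3 := h1.summable.tsum_eq_zero_add
  rw [h1.tsum_eq] at h3
  have h4 : ∀ m : ℕ, betaTerm z (m + 1) +
      (z - (r + 1)) * (betaTerm z (m + 1) / ((m + 1 : ℕ) + ((r : ℝ) + 1))) =
      betaTerm z m - (r + 1) * (betaTerm z m / (m + ((r + 1 : ℕ) + 1))) := by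
    intro m
    have e := betaTerm_succ hz0 m
    push_cast
    have : (0 : ℝ) < (m : ℝ) + 1 + (r + 1) := by positivity
    have : (0 : ℝ) < (m : ℝ) + (r + 1 + 1) := by positivity
    field_simp
    linear_combination ((m : ℝ) + (r + 1 + 1)) * e
  simp_rw [h4] at h3
  rw [h2.tsum_eq, betaTerm_zero] at h3
  have h5 : 1 / z + (z - ((r : ℝ) + 1)) * (1 / z / ((0 : ℕ) + ((r : ℝ) + 1))) = 1 / (r + 1) := by
    have : (0 : ℝ) < (r : ℝ) + 1 := by positivity
    push_cast
    field_simp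
    ring
  rw [h5] at h3
  linarith

theorem betaSeries_zero_sub {z : ℝ} (hz : 2 ≤ z) :
    betaSeries z 0 - betaSeries (z + 1) 0 = 1 / z ^ 2 := by
  have hz0 : 0 < z := by linarith
  have h1 := (summable_betaTerm_div hz 0).hasSum.sub
    (summable_betaTerm_div (z := z + 1) (by linarith) 0).hasSum
  have h2 := (hasSum_betaTerm (z := z + 1) (by linarith)).mul_left (1 / z)
  rw [add_sub_cancel_right] at h2
  refine (h1.unique ?_).trans (by field_simp : 1 / z * (1 / z) = 1 / z ^ 2)
  refine h2.congr_fun fun m => ?_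
  have e1 := betaTerm_sub_betaTerm_add_one hz0 m
  have e2 := betaTerm_succ' hz0 m
  have : (0 : ℝ) < (m : ℝ) + 1 := by positivity
  rw [← sub_div, e1]
  push_cast
  rw [zero_add]
  field_simp
  linarith

theorem trigamma_eq_betaSeries {z : ℝ} (hz : 2 ≤ z) : trigamma z = betaSeries z 0 := by
  have hz0 : 0 < z := by linarith
  rw [trigamma_of_pos hz0]
  refine HasSum.tsum_eq ?_
  rw [hasSum_iff_tendsto_nat_of_nonneg fun n => by positivity]
  have h : ∀ n : ℕ, betaSeries z 0 - betaSeries (z + n) 0 =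
      ∑ i ∈ Finset.range n, 1 / (z + i) ^ 2 := by
    intro n
    induction n with
    | zero => simp
    | succ n ih =>
      have h0 : (0 : ℝ) ≤ n := n.cast_nonneg
      rw [Finset.sum_range_succ, ← ih, ← betaSeries_zero_sub (by linarith : 2 ≤ z + n)]
      push_cast
      rw [add_assoc z]
      ring
  simp_rw [← h]
  have hlim : Tendsto (fun n : ℕ => betaSeries (z + n) 0) atTop (𝓝 0) := by
    refine squeeze_zero (g := fun n : ℕ => 2 / (z + n)) (fun n => ?_) (fun n => ?_) ?_
    · exact tsum_nonneg fun m => div_nonneg (betaTerm_pos (by positivity) m).le (by positivity)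
    · have h0 : (0 : ℝ) ≤ n := n.cast_nonneg
      have h1 := hasSum_one_div_add_one_mul_add_two.mul_left (2 / (z + n))
      rw [mul_one] at h1
      refine hasSum_le (fun m => ?_) (summable_betaTerm_div (by linarith) 0).hasSum h1
      refine (div_le_self (betaTerm_pos (by linarith) m).le ?_).trans (betaTerm_le (by linarith) m)
      have : (0 : ℝ) ≤ (m : ℝ) := by positivity
      push_cast
      linarith
    · exact Tendsto.div_atTop tendsto_const_nhds
        (tendsto_atTop_add_const_left _ _ tendsto_natCast_atTop_atTop)
  simpa using hlim.const_sub (betaSeries z 0)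

/-! ### The closed form of the constant -/

/-- `(q + 1) G(q + 1) - (q - 1 - s) G(q)` for `G(q) = ∑ (-1)^l / ((l + 1) (l - 1 - s) C(q, l + 1))`:
the dependence on `s` cancels except in the last term, and the rest is an alternating sum of
reciprocal binomial coefficients. -/
theorem alternating_sum_recurrence {s : ℝ} (hs : s ∉ Set.range ((↑) : ℤ → ℝ)) (q : ℕ) :
    ((q : ℝ) + 1) * ∑ l ∈ Finset.range (q + 1),
        (-1 : ℝ) ^ l / (((l : ℝ) + 1) * ((l : ℝ) - 1 - s) * ((q + 1).choose (l + 1) : ℝ)) -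
      (q - 1 - s) * ∑ l ∈ Finset.range q,
        (-1 : ℝ) ^ l / (((l : ℝ) + 1) * ((l : ℝ) - 1 - s) * (q.choose (l + 1) : ℝ)) =
      (-1) ^ q / (q - 1 - s) - (1 - (-1) ^ q) / (q + 1) := by
  have hne : ∀ l : ℕ, (l : ℝ) - 1 - s ≠ 0 := fun l h =>
    hs ⟨l - 1, by push_cast; linarith⟩
  rw [Finset.sum_range_succ, mul_add, Finset.mul_sum, Finset.mul_sum]
  have hsum := sum_neg_one_pow_div_ringChoose (w := (q : ℝ) - 1)
    (by have : (0 : ℝ) ≤ q := q.cast_nonneg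
        intro h; linarith) q (fun i hi => by
      rw [sub_add_cancel, Ring.choose_natCast]
      exact_mod_cast (Nat.choose_pos hi).ne')
  rw [sub_add_cancel, Ring.choose_natCast, Nat.choose_self, Nat.cast_one, div_one,
    show (q : ℝ) - 1 + 2 = q + 1 by ring] at hsum
  have hterm : ∀ l ∈ Finset.range q,
      ((q : ℝ) + 1) * ((-1 : ℝ) ^ l /
        (((l : ℝ) + 1) * ((l : ℝ) - 1 - s) * ((q + 1).choose (l + 1) : ℝ))) -
      (q - 1 - s) * ((-1 : ℝ) ^ l /
        (((l : ℝ) + 1) * ((l : ℝ) - 1 - s) * (q.choose (l + 1) : ℝ))) =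
      -(1 / (q : ℝ)) * ((-1 : ℝ) ^ l / Ring.choose ((q : ℝ) - 1) l) := by
    intro l hl
    have hlq := Finset.mem_range.1 hl
    have hq0 : (0 : ℝ) < q := by exact_mod_cast (Nat.zero_le l).trans_lt hlq
    have hlq' : (0 : ℝ) < q - l := by
      rw [sub_pos]; exact_mod_cast hlq
    have hl1 : (0 : ℝ) < (l : ℝ) + 1 := by positivity
    have hc : (0 : ℝ) < q.choose l := by exact_mod_cast Nat.choose_pos hlq.le
    have hr : Ring.choose ((q : ℝ) - 1) l = (q - l) * (q.choose l : ℝ) / q := by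
      rw [← Ring.choose_natCast (R := ℝ), sub_mul_ringChoose]
      field_simp
    have h1 : ((q + 1).choose (l + 1) : ℝ) = (q + 1) * q.choose l / (l + 1) := by
      have := succ_mul_ringChoose_succ' ((q + 1 : ℕ) : ℝ) l
      rw [Ring.choose_natCast, Nat.cast_add, Nat.cast_one, add_sub_cancel_right,
        Ring.choose_natCast] at this
      field_simp
      linarith
    have h2 : (q.choose (l + 1) : ℝ) = (q - l) * q.choose l / (l + 1) := by
      have := succ_mul_ringChoose_succ (q : ℝ) l
      rw [Ring.choose_natCast, Ring.choose_natCast] at this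
      field_simp
      linarith
    rw [hr, h1, h2]
    have := hne l
    field_simp
    ring
  have := Finset.sum_congr rfl hterm
  rw [Finset.sum_sub_distrib, ← Finset.mul_sum _ _ (-(1 / (q : ℝ))), hsum] at this
  rw [add_sub_right_comm, this, Nat.choose_self, Nat.cast_one]
  have h1 : (0 : ℝ) < (q : ℝ) + 1 := by positivity
  have h2 := hne q
  rcases Nat.eq_zero_or_pos q with rfl | hq
  · have h3 := hne 0
    simp at h3 ⊢
  · have h3 : (0 : ℝ) < q := by exact_mod_cast hq
    field_simp
    ring

/-- The closed form of the series for general `s`. Both sides satisfy the same first-order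
recurrence in `q`, and for `q = 0` the identity is the expansion of the trigamma function. -/
theorem betaSeries_eq_closedForm {s : ℝ} (hs0 : 0 < s) (hs : s ∉ Set.range ((↑) : ℤ → ℝ)) (q : ℕ) :
    betaSeries (2 + s) q =
      Ring.choose ((q : ℝ) - 2 - s) q * (trigamma (2 + s - q) -
        ∑ l ∈ Finset.Icc 1 q, 1 / ((l : ℝ) ^ 2 * Ring.choose ((l : ℝ) + 1 + s - q) l)) -
      ∑ l ∈ Finset.range q,
        (-1 : ℝ) ^ l / (((l : ℝ) + 1) * ((l : ℝ) - 1 - s) * (q.choose (l + 1) : ℝ)) := by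
  induction q with
  | zero => simp [trigamma_eq_betaSeries (by linarith : 2 ≤ 2 + s)]
  | succ q ih =>
    obtain ⟨y, hy⟩ : ∃ y : ℝ, y = q - 1 - s := ⟨_, rfl⟩
    have hyint : ∀ j : ℤ, y + j ∉ Set.range ((↑) : ℤ → ℝ) := by
      rintro j ⟨z, hz⟩
      exact hs ⟨q - 1 - z + j, by push_cast; linarith⟩
    have hy0 : y ≠ 0 := fun h => hyint 0 ⟨0, by simp [h]⟩
    have hy1 : y - 1 ≠ 0 := fun h => hyint 0 ⟨1, by push_cast; linarith⟩
    have hcy1 : ∀ l, Ring.choose (y - 1) l ≠ 0 :=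
      ringChoose_ne_zero (by simpa [sub_eq_add_neg] using hyint (-1))
    have hcy2 : ∀ l, Ring.choose (y - 2) l ≠ 0 :=
      ringChoose_ne_zero (by simpa [sub_eq_add_neg] using hyint (-2))
    have hq : (0 : ℝ) < (q : ℝ) + 1 := by positivity
    have hrec := betaSeries_succ (by linarith : 2 ≤ 2 + s) q
    rw [show (q : ℝ) + 1 - (2 + s) = y by rw [hy]; ring] at hrec
    have hG := alternating_sum_recurrence hs q
    have htri := trigamma_sub_nat_succ (x := 2 + s) (by linarith) (by
      rintro ⟨z, hz⟩
      exact hs ⟨z - 2, by push_cast; linarith⟩) q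
    rw [show 2 + s - ((q : ℝ) + 1) = -y by rw [hy]; ring, neg_sq] at htri
    rw [← hy] at hG
    -- the two inner sums, in terms of `y`
    have hA : ∀ l : ℕ, Ring.choose ((l : ℝ) + 1 + s - (q + 1 : ℕ)) l =
        (-1) ^ l * Ring.choose y l := by
      intro l
      rw [← ringChoose_sub_one_sub, hy]
      congr 1
      push_cast
      ring
    have hA' : ∀ l : ℕ, Ring.choose ((l : ℝ) + 1 + s - q) l =
        (-1) ^ l * Ring.choose (y - 1) l := by
      intro l
      rw [← ringChoose_sub_one_sub, hy]
      congr 1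
      ring
    have hB : Ring.choose ((q : ℝ) - 2 - s) q = Ring.choose (y - 1) q := by
      rw [hy]; congr 1; ring
    have hB' : Ring.choose (((q + 1 : ℕ) : ℝ) - 2 - s) (q + 1) = Ring.choose y (q + 1) := by
      rw [hy]; congr 1; push_cast; ring
    have hpow : ∀ l : ℕ, ((-1 : ℝ) ^ l) ≠ 0 := fun l => pow_ne_zero _ (by norm_num)
    have hpow2 : ∀ l : ℕ, ((-1 : ℝ) ^ l) ^ 2 = 1 := fun l => by
      rw [← pow_mul, mul_comm, pow_mul]; simp
    have hterm : ∀ i ∈ Finset.range q,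
        1 / (((1 + i : ℕ) : ℝ) ^ 2 * ((-1) ^ (1 + i) * Ring.choose y (1 + i))) -
        1 / (((1 + i : ℕ) : ℝ) ^ 2 * ((-1) ^ (1 + i) * Ring.choose (y - 1) (1 + i))) =
        1 / (y * (y - 1)) * ((-1 : ℝ) ^ i / Ring.choose (y - 2) i) := by
      intro i _
      have hi : (0 : ℝ) < (i : ℝ) + 1 := by positivity
      have e1 := succ_mul_ringChoose_succ' y i
      have e2 := succ_mul_ringChoose_succ (y - 1) i
      have e3 := sub_mul_ringChoose (y - 1) i
      rw [show y - 1 - 1 = y - 2 by ring] at e3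
      have hyi : y - 1 - i ≠ 0 := fun h => hyint 0 ⟨1 + i, by push_cast; linarith⟩
      have e3' : Ring.choose (y - 1) i = (y - 1) * Ring.choose (y - 2) i / (y - 1 - i) := by
        rw [← e3]; field_simp
      have e1' : Ring.choose y (1 + i) = y * Ring.choose (y - 1) i / (i + 1) := by
        rw [← e1, add_comm 1 i]; field_simp
      have e2' : Ring.choose (y - 1) (1 + i) =
          (y - 1 - i) * Ring.choose (y - 1) i / (i + 1) := by
        rw [← e2, add_comm 1 i]; field_simp
      have := hcy2 i
      rw [e1', e2', e3', add_comm 1 i, pow_succ (-1 : ℝ) i]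
      push_cast
      have h2 := hpow2 i
      have h3 := hpow i
      field_simp
      linear_combination -((i : ℝ) + 1) * h2
    have hsum := Finset.sum_congr rfl hterm
    have htel := sum_neg_one_pow_div_ringChoose (w := y - 2) (by simpa using hy0) q
      (fun i _ => by rw [show y - 2 + 1 = y - 1 by ring]; exact hcy1 i)
    rw [show y - 2 + 1 = y - 1 by ring, show y - 2 + 2 = y by ring] at htel
    rw [Finset.sum_sub_distrib, ← Finset.mul_sum, htel] at hsum
    rw [ih, hB] at hrec
    rw [hB', show 2 + s - ((q + 1 : ℕ) : ℝ) = -y by rw [hy]; push_cast; ring, htri]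
    simp_rw [hA]
    simp_rw [hA'] at hrec
    have hIcc : ∀ (n : ℕ) (f : ℕ → ℝ), ∑ l ∈ Finset.Icc 1 n, f l =
        ∑ i ∈ Finset.range n, f (1 + i) := by
      intro n f
      rw [← Finset.Ico_add_one_right_eq_Icc, Finset.sum_Ico_eq_sum_range, Nat.add_sub_cancel]
    rw [hIcc] at hrec ⊢
    rw [Finset.sum_range_succ, add_comm 1 q]
    have e1 := succ_mul_ringChoose_succ' y q
    have hBB : Ring.choose y (q + 1) = y * Ring.choose (y - 1) q / (q + 1) := by
      rw [← e1]; field_simp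
    refine mul_left_cancel₀ hq.ne' ?_
    rw [hrec, hBB]
    generalize betaSeries (2 + s) (q + 1) = X1 at *
    generalize trigamma (2 + s - q) = X2 at *
    generalize (∑ l ∈ Finset.range (q + 1),
        (-1 : ℝ) ^ l / (((l : ℝ) + 1) * ((l : ℝ) - 1 - s) * ((q + 1).choose (l + 1) : ℝ))) = X3 at *
    generalize (∑ l ∈ Finset.range q,
        (-1 : ℝ) ^ l / (((l : ℝ) + 1) * ((l : ℝ) - 1 - s) * (q.choose (l + 1) : ℝ))) = X4 at *
    rw [sub_eq_iff_eq_add] at hsum hG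
    rw [hsum]
    have hX3 : (q + 1) * X3 = _ := hG
    rw [mul_sub ((q : ℝ) + 1), hX3]
    have h1 := hpow q
    have h2 := hpow2 q
    have h3 := hcy1 q
    rw [pow_succ (-1 : ℝ) q]
    generalize (∑ x ∈ Finset.range q,
      1 / (((1 + x : ℕ) : ℝ) ^ 2 * ((-1) ^ (1 + x) * Ring.choose (y - 1) (1 + x)))) = X5 at *
    generalize (-1 : ℝ) ^ q = e at *
    push_cast
    field_simp
    linear_combination y * h2

/-! ### The limiting constant -/

theorem betaTerm_two_add (s : ℝ) (hs : 0 < s) (m : ℕ) :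
    betaTerm (2 + s) m = 1 / (((m : ℝ) + 1) * Ring.choose ((m : ℝ) + 2 + s) (m + 1)) := by
  have hz : 0 < 2 + s := by linarith
  have key : betaTerm (2 + s) m * (((m : ℝ) + 1) * Ring.choose ((m : ℝ) + 2 + s) (m + 1)) = 1 := by
    induction m with
    | zero =>
      rw [betaTerm_zero]
      simp
      field_simp
    | succ m ih =>
      have h1 := succ_mul_ringChoose_succ' (((m + 1 : ℕ) : ℝ) + 2 + s) (m + 1)
      have h2 := betaTerm_succ hz m
      rw [show ((m + 1 : ℕ) : ℝ) + 2 + s - 1 = m + 2 + s by push_cast; ring] at h1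
      push_cast at h1 h2 ⊢
      rw [h1]
      linear_combination Ring.choose ((m : ℝ) + 2 + s) (m + 1) * h2 + ih
  exact eq_one_div_of_mul_eq_one_left key

/-- The limiting proportion of the inserted nodes which are a parent of exactly `m` nodes. -/
noncomputable def degreeLimit (k m : ℕ) : ℝ := ((k : ℝ) + 1) / k * betaTerm (2 + 1 / (k : ℝ)) m

/-- The local clustering coefficient of an inserted node which is a parent of exactly `m` nodes. -/
noncomputable def nodeClustering (k m : ℕ) : ℝ :=
  ((k : ℝ) - 1) * (k + 2 * m) / ((k + m) * (k + m - 1))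

theorem clusteringTerm_eq {k : ℕ} (hk : 2 ≤ k) (m : ℕ) :
    clusteringTerm k m = degreeLimit k m * nodeClustering k m := by
  have hk' : (2 : ℝ) ≤ k := by exact_mod_cast hk
  have hk0 : (0 : ℝ) < k := by linarith
  have hm : (0 : ℝ) ≤ m := m.cast_nonneg
  have hb := betaTerm_two_add (1 / (k : ℝ)) (by positivity) m
  have hbpos := betaTerm_pos (by positivity : 0 < 2 + 1 / (k : ℝ)) m
  have hC : Ring.choose ((m : ℝ) + 2 + 1 / (k : ℝ)) (m + 1) ≠ 0 := by
    intro h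
    rw [h] at hb
    simp at hb
    rw [one_div] at hbpos
    exact hbpos.ne' hb
  have h2 : (0 : ℝ) < m + k - 1 := by linarith
  have h3 : (0 : ℝ) < k + m - 1 := by linarith
  rw [clusteringTerm, degreeLimit, nodeClustering, hb]
  generalize Ring.choose ((m : ℝ) + 2 + 1 / (k : ℝ)) (m + 1) = C at *
  field_simp
  ring

theorem nodeClustering_eq {k : ℕ} (hk : 2 ≤ k) (m : ℕ) :
    nodeClustering k m = 1 - (m : ℝ) * (m + 1) / ((k + m) * (k + m - 1)) := by
  have hk' : (2 : ℝ) ≤ k := by exact_mod_cast hk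
  have hm : (0 : ℝ) ≤ m := m.cast_nonneg
  have h3 : (0 : ℝ) < k + m - 1 := by linarith
  have h4 : (0 : ℝ) < k + m := by linarith
  rw [nodeClustering]
  field_simp
  ring

theorem nodeClustering_nonneg {k : ℕ} (hk : 2 ≤ k) (m : ℕ) : 0 ≤ nodeClustering k m := by
  have hk' : (2 : ℝ) ≤ k := by exact_mod_cast hk
  have hm : (0 : ℝ) ≤ m := m.cast_nonneg
  have h3 : (0 : ℝ) < k + m - 1 := by linarith
  have h4 : (0 : ℝ) < k - 1 := by linarith
  unfold nodeClustering
  positivity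

theorem nodeClustering_le_one {k : ℕ} (hk : 2 ≤ k) (m : ℕ) : nodeClustering k m ≤ 1 := by
  have hk' : (2 : ℝ) ≤ k := by exact_mod_cast hk
  have hm : (0 : ℝ) ≤ m := m.cast_nonneg
  have h3 : (0 : ℝ) < k + m - 1 := by linarith
  rw [nodeClustering_eq hk, sub_le_self_iff]
  positivity

theorem tendsto_nodeClustering_left (m : ℕ) :
    Tendsto (fun k : ℕ => nodeClustering k m) atTop (𝓝 1) := by
  have h : Tendsto (fun k : ℕ => 1 - (m : ℝ) * (m + 1) / (((k : ℝ) + m) * (k + m - 1)))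
      atTop (𝓝 (1 - 0)) := by
    refine (Tendsto.div_atTop tendsto_const_nhds ?_).const_sub 1
    refine Tendsto.atTop_mul_atTop₀ ?_ ?_
    · exact tendsto_atTop_add_const_right _ _ tendsto_natCast_atTop_atTop
    · exact tendsto_atTop_add_const_right _ _
        (tendsto_atTop_add_const_right _ _ tendsto_natCast_atTop_atTop)
  rw [sub_zero] at h
  refine h.congr' ?_
  filter_upwards [eventually_ge_atTop 2] with k hk using (nodeClustering_eq hk m).symm

theorem nodeClustering_le {k : ℕ} (hk : 2 ≤ k) (m : ℕ) :
    nodeClustering k m ≤ 2 * (k : ℝ) / (m + 1) := by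
  have hk' : (2 : ℝ) ≤ k := by exact_mod_cast hk
  have hm : (0 : ℝ) ≤ m := m.cast_nonneg
  have h3 : (0 : ℝ) < k + m - 1 := by linarith
  rw [nodeClustering, div_le_div_iff₀ (by positivity) (by positivity)]
  have h1 : ((k : ℝ) - 1) * (k + 2 * m) ≤ 2 * k * (k + m) := by nlinarith
  have h2 : (m : ℝ) + 1 ≤ k + m - 1 := by linarith
  calc ((k : ℝ) - 1) * (k + 2 * m) * (m + 1) ≤ 2 * k * (k + m) * (k + m - 1) := by
        gcongr
    _ = _ := by ring

theorem degreeLimit_nonneg (k m : ℕ) : 0 ≤ degreeLimit k m := by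
  have := (betaTerm_pos (by positivity : 0 < 2 + 1 / (k : ℝ)) m).le
  unfold degreeLimit
  positivity

theorem degreeLimit_le {k : ℕ} (hk : 1 ≤ k) (m : ℕ) :
    degreeLimit k m ≤ 2 * (1 / (((m : ℝ) + 1) * (m + 2))) := by
  have hk' : (1 : ℝ) ≤ k := by exact_mod_cast hk
  have hk0 : (0 : ℝ) < k := by linarith
  have hz : 2 ≤ 2 + 1 / (k : ℝ) := by
    have : 0 < 1 / (k : ℝ) := by positivity
    linarith
  have h1 : ((k : ℝ) + 1) / k ≤ 2 := by
    rw [div_le_iff₀ hk0]; linarith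
  have h2 : 2 / (2 + 1 / (k : ℝ)) ≤ 1 := (div_le_one (by linarith)).2 hz
  calc degreeLimit k m ≤ 2 * (1 * (1 / (((m : ℝ) + 1) * (m + 2)))) := by
        unfold degreeLimit
        gcongr
        · exact (betaTerm_pos (by linarith) m).le
        · exact (betaTerm_le hz m).trans (by gcongr)
    _ = _ := by ring

theorem clusteringTerm_nonneg {k : ℕ} (hk : 2 ≤ k) (m : ℕ) : 0 ≤ clusteringTerm k m := by
  rw [clusteringTerm_eq hk]
  exact mul_nonneg (degreeLimit_nonneg k m) (nodeClustering_nonneg hk m)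

theorem clusteringTerm_le {k : ℕ} (hk : 2 ≤ k) (m : ℕ) :
    clusteringTerm k m ≤ 2 * (1 / (((m : ℝ) + 1) * (m + 2))) := by
  rw [clusteringTerm_eq hk]
  exact (mul_le_of_le_one_right (degreeLimit_nonneg k m) (nodeClustering_le_one hk m)).trans
    (degreeLimit_le (by omega) m)

theorem summable_clusteringTerm {k : ℕ} (hk : 2 ≤ k) : Summable (clusteringTerm k) :=
  Summable.of_nonneg_of_le (clusteringTerm_nonneg hk) (clusteringTerm_le hk)
    (hasSum_one_div_add_one_mul_add_two.summable.mul_left 2)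

theorem one_div_natCast_notMem_range_intCast {k : ℕ} (hk : 2 ≤ k) :
    1 / (k : ℝ) ∉ Set.range ((↑) : ℤ → ℝ) := by
  rintro ⟨z, hz⟩
  have hk' : (2 : ℝ) ≤ k := by exact_mod_cast hk
  have h1 : (0 : ℝ) < z := by rw [hz]; positivity
  have h2 : (z : ℝ) < 1 := by
    rw [hz, div_lt_one (by linarith)]; linarith
  have h1' : 0 < z := by exact_mod_cast h1
  have h2' : z < 1 := by exact_mod_cast h2
  omega

theorem clusteringLimit_eq_closedForm {k : ℕ} (hk : 2 ≤ k) :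
    clusteringLimit k = clusteringClosedForm k := by
  obtain ⟨q, rfl⟩ := Nat.exists_eq_add_of_le' hk
  obtain ⟨s, hs⟩ : ∃ s : ℝ, s = 1 / ((q + 2 : ℕ) : ℝ) := ⟨_, rfl⟩
  have hsint : s ∉ Set.range ((↑) : ℤ → ℝ) := hs ▸ one_div_natCast_notMem_range_intCast hk
  have hs0 : 0 < s := by rw [hs]; positivity
  have hq : (0 : ℝ) ≤ q := q.cast_nonneg
  have hz : 2 ≤ 2 + s := by linarith
  have h1 : clusteringLimit (q + 2) = ((q : ℝ) + 3) * (q + 1) / (q + 2) *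
      ((q + 2) * betaSeries (2 + s) (q + 1) - q * betaSeries (2 + s) q) := by
    refine HasSum.tsum_eq ?_
    refine ((((summable_betaTerm_div hz (q + 1)).hasSum.mul_left ((q : ℝ) + 2)).sub
      ((summable_betaTerm_div hz q).hasSum.mul_left (q : ℝ))).mul_left
        (((q : ℝ) + 3) * (q + 1) / (q + 2))).congr_fun fun m => ?_
    have hm : (0 : ℝ) ≤ m := m.cast_nonneg
    have h3 : (0 : ℝ) < (q : ℝ) + 2 + m - 1 := by linarith
    rw [clusteringTerm_eq hk, degreeLimit, nodeClustering, ← hs]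
    push_cast
    field_simp
    ring
  have h2 := betaSeries_succ hz q
  have h3 : clusteringLimit (q + 2) =
      ((q : ℝ) + 3) * (1 / (q + 1) - 3 / (q + 2) * betaSeries (2 + s) q) := by
    have h4 : betaSeries (2 + s) (q + 1) =
        (1 / (q + 1) + (q + 1 - (2 + s)) * betaSeries (2 + s) q) / (q + 1) := by
      rw [← h2]; field_simp
    rw [h1, h4]
    have hs' : s = 1 / ((q : ℝ) + 2) := by rw [hs]; push_cast; rfl
    generalize betaSeries (2 + s) q = X at *
    rw [hs']
    field_simp
    ring
  rw [h3, betaSeries_eq_closedForm hs0 hsint q, clusteringClosedForm, ← hs]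
  have e1 : (((q + 2 : ℕ) : ℝ) - 4 - s) = (q : ℝ) - 2 - s := by push_cast; ring
  have e2 : (4 + s - ((q + 2 : ℕ) : ℝ)) = 2 + s - q := by push_cast; ring
  have e3 : ∀ l : ℕ, ((l : ℝ) + 3 + s - ((q + 2 : ℕ) : ℝ)) = (l : ℝ) + 1 + s - q := by
    intro l; push_cast; ring
  simp_rw [e3]
  rw [e1, e2, Nat.add_sub_cancel]
  push_cast
  rw [show (q : ℝ) + 2 - 1 = q + 1 by ring]
  ring

/-! ### Special values and large `k` -/

theorem trigamma_add_one {x : ℝ} (hx : 0 < x) : trigamma (x + 1) = trigamma x - 1 / x ^ 2 := by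
  rw [trigamma_of_pos hx, trigamma_of_pos (by linarith),
    (summable_one_div_add_sq x).tsum_eq_zero_add]
  simp [add_assoc, add_comm (1 : ℝ)]

theorem trigamma_one_half : trigamma (1 / 2) = Real.pi ^ 2 / 2 := by
  have he : HasSum (fun n : ℕ => (1 : ℝ) / ((2 * n : ℕ) : ℝ) ^ 2) (1 / 4 * (Real.pi ^ 2 / 6)) := by
    have h := hasSum_zeta_two.mul_left (1 / 4)
    have e : (fun n : ℕ => (1 : ℝ) / 4 * (1 / (n : ℝ) ^ 2)) =
        fun n : ℕ => (1 : ℝ) / ((2 * n : ℕ) : ℝ) ^ 2 := by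
      funext n
      rw [Nat.cast_mul, mul_pow, Nat.cast_ofNat, div_mul_div_comm]
      norm_num
    rwa [e] at h
  have ho : HasSum (fun n : ℕ => (1 : ℝ) / ((2 * n + 1 : ℕ) : ℝ) ^ 2)
      (1 / 4 * trigamma (1 / 2)) := by
    have h := (summable_one_div_add_sq (1 / 2)).hasSum.mul_left (1 / 4)
    rw [← trigamma_of_pos one_half_pos] at h
    have e : (fun n : ℕ => (1 : ℝ) / 4 * (1 / (1 / 2 + (n : ℝ)) ^ 2)) =
        fun n : ℕ => (1 : ℝ) / ((2 * n + 1 : ℕ) : ℝ) ^ 2 := by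
      funext n
      rw [show ((2 * n + 1 : ℕ) : ℝ) = 2 * (1 / 2 + n) by push_cast; ring, mul_pow,
        div_mul_div_comm]
      norm_num
    rwa [e] at h
  have := (he.even_add_odd (f := fun n : ℕ => (1 : ℝ) / (n : ℝ) ^ 2) ho).unique hasSum_zeta_two
  linarith

theorem clusteringLimit_two : clusteringLimit 2 = 23 - 9 * Real.pi ^ 2 / 4 := by
  rw [clusteringLimit_eq_closedForm le_rfl, clusteringClosedForm]
  have h : trigamma (4 + 1 / ((2 : ℕ) : ℝ) - (2 : ℕ)) = Real.pi ^ 2 / 2 - 4 - 4 / 9 := by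
    rw [show (4 + 1 / ((2 : ℕ) : ℝ) - (2 : ℕ)) = 1 / 2 + 1 + 1 by norm_num,
      trigamma_add_one (by norm_num), trigamma_add_one (by norm_num), trigamma_one_half]
    norm_num
  rw [h]
  simp
  ring

theorem betaTerm_two (m : ℕ) : betaTerm 2 m = 1 / (((m : ℝ) + 1) * (m + 2)) := by
  induction m with
  | zero => simp [betaTerm_zero]
  | succ m ih =>
    have h := betaTerm_succ (z := 2) (by norm_num) m
    rw [ih] at h
    push_cast
    field_simp at h ⊢
    linarith

theorem tendsto_clusteringLimit : Tendsto clusteringLimit atTop (𝓝 1) := by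
  have h1 : ∀ m : ℕ, Tendsto (fun k : ℕ => clusteringTerm k m) atTop
      (𝓝 (1 / (((m : ℝ) + 1) * (m + 2)))) := by
    intro m
    have hz : Tendsto (fun k : ℕ => 1 / (k : ℝ)) atTop (𝓝 0) := tendsto_one_div_atTop_nhds_zero_nat
    have hc : ContinuousAt (fun z => betaTerm z m) 2 := by
      unfold betaTerm
      refine ContinuousAt.div continuousAt_const (by fun_prop) ?_
      exact (Finset.prod_pos fun i _ => by positivity).ne'
    have hb : Tendsto (fun k : ℕ => betaTerm (2 + 1 / (k : ℝ)) m) atTop (𝓝 (betaTerm 2 m)) := by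
      refine hc.tendsto.comp ?_
      simpa using hz.const_add 2
    have h := ((hz.const_add 1).mul hb).mul (tendsto_nodeClustering_left m)
    rw [add_zero, one_mul, mul_one, betaTerm_two] at h
    refine h.congr' ?_
    filter_upwards [eventually_ge_atTop 2] with k hk
    have : (0 : ℝ) < k := by exact_mod_cast (by omega : 0 < k)
    rw [clusteringTerm_eq hk, degreeLimit]
    congr 2
    field_simp
  have := tendsto_tsum_of_dominated_convergence (𝓕 := atTop) (f := clusteringTerm)
    (g := fun m : ℕ => 1 / (((m : ℝ) + 1) * (m + 2)))
    (bound := fun m : ℕ => 2 * (1 / (((m : ℝ) + 1) * (m + 2))))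
    (hasSum_one_div_add_one_mul_add_two.summable.mul_left 2) h1 (by
      filter_upwards [eventually_ge_atTop 2] with k hk m
      rw [Real.norm_of_nonneg (clusteringTerm_nonneg hk m)]
      exact clusteringTerm_le hk m)
  rwa [hasSum_one_div_add_one_mul_add_two.tsum_eq] at this

/-! ### Adding the last node to an ordered increasing tree -/

namespace KTreeNode

variable {k n : ℕ}

/-- The inclusion of the nodes of a tree of size `n` into those of a tree of size `n + 1`. -/
def old : KTreeNode k n → KTreeNode k (n + 1) := Sum.map id Fin.castSucc

/-- The last inserted node of a tree of size `n + 1`. -/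
def new : KTreeNode k (n + 1) := Sum.inr (Fin.last n)

theorem old_injective : Function.Injective (old : KTreeNode k n → KTreeNode k (n + 1)) :=
  Function.injective_id.sumMap (Fin.castSucc_injective n)

@[simp] theorem old_inj {a b : KTreeNode k n} : old a = old b ↔ a = b := old_injective.eq_iff

@[simp] theorem old_ne_new (a : KTreeNode k n) : old a ≠ new := by
  rcases a with a | a
  · simp [old, new]
  · simp [old, new]

@[simp] theorem new_ne_old (a : KTreeNode k n) : new ≠ old a := (old_ne_new a).symm

@[simp] theorem inr_castSucc (j : Fin n) :
    (Sum.inr j.castSucc : KTreeNode k (n + 1)) = old (Sum.inr j) := rfl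

@[simp] theorem inr_last : (Sum.inr (Fin.last n) : KTreeNode k (n + 1)) = new := rfl

@[simp] theorem old_inl (a : Fin k) : old (Sum.inl a : KTreeNode k n) = Sum.inl a := rfl

@[simp] theorem label_old (a : KTreeNode k n) : label (old a) = label a := by
  rcases a with a | a <;> rfl

@[simp] theorem label_new : label (new : KTreeNode k (n + 1)) = n + 1 := rfl

theorem label_le (a : KTreeNode k n) : label a ≤ n := by
  rcases a with a | a
  · exact Nat.zero_le _
  · exact a.2

theorem old_or_new (a : KTreeNode k (n + 1)) : (∃ b, a = old b) ∨ a = new := by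
  rcases a with a | a
  · exact Or.inl ⟨Sum.inl a, rfl⟩
  · induction a using Fin.lastCases with
    | last => exact Or.inr rfl
    | cast j => exact Or.inl ⟨Sum.inr j, rfl⟩

/-- The graph `G` with one more inserted node, joined to the nodes of `K`. -/
def addNode (G : SimpleGraph (KTreeNode k n)) (K : Set (KTreeNode k n)) :
    SimpleGraph (KTreeNode k (n + 1)) where
  Adj a b := (∃ x y, a = old x ∧ b = old y ∧ G.Adj x y) ∨ (a = new ∧ ∃ y ∈ K, b = old y) ∨
    (b = new ∧ ∃ x ∈ K, a = old x)
  symm := ⟨by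
    rintro a b (⟨x, y, ha, hb, h⟩ | h | h)
    · exact Or.inl ⟨y, x, hb, ha, h.symm⟩
    · exact Or.inr (Or.inr h)
    · exact Or.inr (Or.inl h)⟩
  loopless := ⟨by
    rintro a (⟨x, y, ha, hb, h⟩ | ⟨h, y, -, hy⟩ | ⟨h, y, -, hy⟩)
    · rw [ha, old_inj] at hb
      exact h.ne hb
    · exact new_ne_old y (h.symm.trans hy)
    · exact new_ne_old y (h.symm.trans hy)⟩

variable {G : SimpleGraph (KTreeNode k n)} {K : Set (KTreeNode k n)}

@[simp] theorem addNode_adj_old_old {a b : KTreeNode k n} :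
    (addNode G K).Adj (old a) (old b) ↔ G.Adj a b := by
  simp [addNode, -Sum.exists]

@[simp] theorem addNode_adj_new_old {a : KTreeNode k n} :
    (addNode G K).Adj new (old a) ↔ a ∈ K := by
  simp [addNode, -Sum.exists]

@[simp] theorem addNode_adj_old_new {a : KTreeNode k n} :
    (addNode G K).Adj (old a) new ↔ a ∈ K := by
  simp [addNode, -Sum.exists]

theorem parents_addNode_castSucc (j : Fin n) :
    parents (addNode G K) j.castSucc = old '' parents G j := by
  ext a
  rcases old_or_new a with ⟨b, rfl⟩ | rfl
  · simp [parents]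
  · have := label_le (Sum.inr j : KTreeNode k n)
    simp [parents]
    omega

theorem parents_addNode_last : parents (addNode G K) (Fin.last n) = old '' K := by
  ext a
  rcases old_or_new a with ⟨b, rfl⟩ | rfl
  · have := label_le b
    simp [parents]
    omega
  · simp [parents]

theorem isClique_addNode_image {S : Set (KTreeNode k n)} (h : G.IsClique S) :
    (addNode G K).IsClique (old '' S) := by
  rintro _ ⟨a, ha, rfl⟩ _ ⟨b, hb, rfl⟩ hab
  rw [addNode_adj_old_old]
  exact h ha hb fun e => hab (e ▸ rfl)

theorem parents_eq_image_old (G : SimpleGraph (KTreeNode k (n + 1))) (j : Fin n) :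
    parents G j.castSucc = old '' parents (G.comap old) j := by
  ext a
  rcases old_or_new a with ⟨b, rfl⟩ | rfl
  · simp [parents]
  · have := label_le (Sum.inr j : KTreeNode k n)
    simp [parents]
    omega

theorem not_mem_parents_self (G : SimpleGraph (KTreeNode k n)) (j : Fin n) :
    Sum.inr j ∉ parents G j := fun h => lt_irrefl _ h.2

theorem parents_last_eq_image_old (G : SimpleGraph (KTreeNode k (n + 1))) :
    parents G (Fin.last n) = old '' (old ⁻¹' parents G (Fin.last n)) := by
  ext a
  rcases old_or_new a with ⟨b, rfl⟩ | rfl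
  · simp
  · exact iff_of_false (not_mem_parents_self G (Fin.last n)) (by simp [-Sum.exists])

end KTreeNode

namespace OrderedIncreasingKTree

open KTreeNode

variable {k n : ℕ}

/-- The `k`-cliques of an ordered increasing `k`-tree, as sets of nodes. -/
abbrev Clique (T : OrderedIncreasingKTree k n) : Type :=
  {K : Set (KTreeNode k n) // T.graph.IsClique K ∧ K.ncard = k}

noncomputable instance (T : OrderedIncreasingKTree k n) : Fintype T.Clique := Fintype.ofFinite _

/-- The ways to add a node to a tree: as the last child of a `k`-clique, or as a child of the
parents of an existing inserted node, directly before this node. -/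
abbrev Slot (T : OrderedIncreasingKTree k n) : Type := T.Clique ⊕ Fin n

/-- The parents of the node added at a slot. -/
def Slot.parents {T : OrderedIncreasingKTree k n} : T.Slot → Set (KTreeNode k n) :=
  Sum.elim (fun K => K.1) fun j => KTreeNode.parents T.graph j

/-- The nodes that precede the node added at a slot in the order of the children of its parents. -/
def Slot.preceding {T : OrderedIncreasingKTree k n} : T.Slot → Set (Fin n) :=
  Sum.elim (fun K => {i | KTreeNode.parents T.graph i = K.1}) fun j => {i | T.before i j}

/-- Add a node with set of parents `K` whose preceding siblings are the nodes in `L`, an initial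
segment of the children of `K`. -/
def insertNode (T : OrderedIncreasingKTree k n) (K : Set (KTreeNode k n)) (L : Set (Fin n))
    (hK : T.graph.IsClique K ∧ K.ncard = k) (hL : ∀ i ∈ L, parents T.graph i = K)
    (hlow : ∀ i ∈ L, ∀ j, T.before j i → j ∈ L) : OrderedIncreasingKTree k (n + 1) where
  graph := addNode T.graph K
  root_clique a b h := by
    rw [← old_inl a, ← old_inl b, addNode_adj_old_old]
    exact T.root_clique a b h
  parents_clique j := by
    induction j using Fin.lastCases with
    | last =>
      rw [parents_addNode_last]
      exact isClique_addNode_image hK.1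
    | cast j =>
      rw [parents_addNode_castSucc]
      exact isClique_addNode_image (T.parents_clique j)
  parents_card j := by
    induction j using Fin.lastCases with
    | last => rw [parents_addNode_last, Set.ncard_image_of_injective _ old_injective, hK.2]
    | cast j =>
      rw [parents_addNode_castSucc, Set.ncard_image_of_injective _ old_injective, T.parents_card]
  before i j := (∃ a b, i = Fin.castSucc a ∧ j = Fin.castSucc b ∧ T.before a b) ∨
    (j = Fin.last n ∧ ∃ a ∈ L, i = Fin.castSucc a) ∨
    (i = Fin.last n ∧ ∃ b, parents T.graph b = K ∧ b ∉ L ∧ j = Fin.castSucc b)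
  before_siblings i j := by
    rintro (⟨a, b, rfl, rfl, h⟩ | ⟨rfl, a, ha, rfl⟩ | ⟨rfl, b, hb, -, rfl⟩)
    · rw [parents_addNode_castSucc, parents_addNode_castSucc, T.before_siblings a b h]
    · rw [parents_addNode_castSucc, parents_addNode_last, hL a ha]
    · rw [parents_addNode_castSucc, parents_addNode_last, hb]
  before_irrefl i := by
    rintro (⟨a, b, rfl, hb, h⟩ | ⟨rfl, a, ha, h⟩ | ⟨rfl, b, hb, -, h⟩)
    · rw [Fin.castSucc_inj] at hb
      subst hb
      exact T.before_irrefl _ h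
    · exact Fin.castSucc_ne_last _ h.symm
    · exact Fin.castSucc_ne_last _ h.symm
  before_trans i j l := by
    have hne := fun a : Fin n => Fin.castSucc_ne_last a
    rintro (⟨a, b, rfl, rfl, h⟩ | ⟨rfl, a, ha, rfl⟩ | ⟨rfl, b, hb, hbL, rfl⟩)
      (⟨c, d, hc, rfl, h'⟩ | ⟨hc, c, hcL, hc'⟩ | ⟨hc, d, hd, hdL, rfl⟩)
    · rw [Fin.castSucc_inj] at hc
      subst hc
      exact Or.inl ⟨_, _, rfl, rfl, T.before_trans _ _ _ h h'⟩
    · rw [Fin.castSucc_inj] at hc'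
      subst hc'
      exact Or.inr (Or.inl ⟨hc, a, hlow _ hcL _ h, rfl⟩)
    · exact absurd hc (hne _)
    · exact absurd hc.symm (hne _)
    · exact absurd hc'.symm (hne _)
    · refine Or.inl ⟨_, _, rfl, rfl, ?_⟩
      have had : a ≠ d := fun e => hdL (e ▸ ha)
      refine (T.before_total a d ((hL a ha).trans hd.symm) had).resolve_right fun hda => ?_
      exact hdL (hlow a ha d hda)
    · rw [Fin.castSucc_inj] at hc
      subst hc
      refine Or.inr (Or.inr ⟨rfl, d, (T.before_siblings _ _ h').symm.trans hb, ?_, rfl⟩)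
      exact fun hd => hbL (hlow d hd _ h')
    · rw [Fin.castSucc_inj] at hc'
      subst hc'
      exact absurd hcL hbL
    · exact absurd hc (hne _)
  before_total i j := by
    induction i using Fin.lastCases with
    | last =>
      induction j using Fin.lastCases with
      | last => exact fun _ h => absurd rfl h
      | cast j =>
        rw [parents_addNode_castSucc, parents_addNode_last, old_injective.image_injective.eq_iff]
        intro h _
        by_cases hj : j ∈ L
        · exact Or.inr (Or.inr (Or.inl ⟨rfl, j, hj, rfl⟩))
        · exact Or.inl (Or.inr (Or.inr ⟨rfl, j, h.symm, hj, rfl⟩))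
    | cast i =>
      induction j using Fin.lastCases with
      | last =>
        rw [parents_addNode_castSucc, parents_addNode_last, old_injective.image_injective.eq_iff]
        intro h _
        by_cases hj : i ∈ L
        · exact Or.inl (Or.inr (Or.inl ⟨rfl, i, hj, rfl⟩))
        · exact Or.inr (Or.inr (Or.inr ⟨rfl, i, h, hj, rfl⟩))
      | cast j =>
        rw [parents_addNode_castSucc, parents_addNode_castSucc,
          old_injective.image_injective.eq_iff]
        intro h hij
        rcases T.before_total i j h fun e => hij (e ▸ rfl) with h | h
        · exact Or.inl (Or.inl ⟨_, _, rfl, rfl, h⟩)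
        · exact Or.inr (Or.inl ⟨_, _, rfl, rfl, h⟩)

/-- Add a node to a tree at a slot. -/
def insertAt (T : OrderedIncreasingKTree k n) (e : T.Slot) : OrderedIncreasingKTree k (n + 1) :=
  T.insertNode e.parents e.preceding
    (by
      rcases e with K | j
      · exact K.2
      · exact ⟨T.parents_clique j, T.parents_card j⟩)
    (by
      rcases e with K | j
      · exact fun i hi => hi
      · exact fun i hi => T.before_siblings i j hi)
    (by
      rcases e with K | j
      · exact fun i hi l hl => (T.before_siblings l i hl).trans hi
      · exact fun i hi l hl => T.before_trans l i j hl hi)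

theorem insertAt_before_castSucc_castSucc (T : OrderedIncreasingKTree k n) (e : T.Slot)
    (i j : Fin n) : (T.insertAt e).before i.castSucc j.castSucc ↔ T.before i j := by
  simp [insertAt, insertNode, Fin.castSucc_ne_last]

theorem insertAt_before_castSucc_last (T : OrderedIncreasingKTree k n) (e : T.Slot) (i : Fin n) :
    (T.insertAt e).before i.castSucc (Fin.last n) ↔ i ∈ e.preceding := by
  simp [insertAt, insertNode, Fin.castSucc_ne_last, (Fin.castSucc_ne_last _).symm]

theorem insertAt_before_last_castSucc (T : OrderedIncreasingKTree k n) (e : T.Slot) (i : Fin n) :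
    (T.insertAt e).before (Fin.last n) i.castSucc ↔
      parents T.graph i = e.parents ∧ i ∉ e.preceding := by
  simp [insertAt, insertNode, Fin.castSucc_ne_last, (Fin.castSucc_ne_last _).symm]

theorem insertAt_graph (T : OrderedIncreasingKTree k n) (e : T.Slot) :
    (T.insertAt e).graph = addNode T.graph e.parents := rfl

/-- The tree without its last node. -/
def removeLast (T : OrderedIncreasingKTree k (n + 1)) : OrderedIncreasingKTree k n where
  graph := T.graph.comap old
  root_clique a b h := T.root_clique a b h
  parents_clique j := by
    have h := T.parents_clique j.castSucc
    rw [parents_eq_image_old] at h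
    exact fun a ha b hb hab => h ⟨a, ha, rfl⟩ ⟨b, hb, rfl⟩ (old_injective.ne hab)
  parents_card j := by
    have h := T.parents_card j.castSucc
    rwa [parents_eq_image_old, Set.ncard_image_of_injective _ old_injective] at h
  before i j := T.before i.castSucc j.castSucc
  before_siblings i j h := by
    have h := T.before_siblings _ _ h
    rwa [parents_eq_image_old, parents_eq_image_old, old_injective.image_injective.eq_iff] at h
  before_irrefl i := T.before_irrefl _
  before_trans i j l := T.before_trans _ _ _
  before_total i j h hij := T.before_total _ _
    (by rw [parents_eq_image_old, parents_eq_image_old, h]) fun e =>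
      hij (Fin.castSucc_injective n e)

theorem removeLast_insertAt (T : OrderedIncreasingKTree k n) (e : T.Slot) :
    (T.insertAt e).removeLast = T := by
  ext a b
  · exact addNode_adj_old_old
  · exact T.insertAt_before_castSucc_castSucc e a b

theorem Slot.ext {T : OrderedIncreasingKTree k n} {e f : T.Slot} (hp : e.parents = f.parents)
    (hl : e.preceding = f.preceding) : e = f := by
  rcases e with K | i <;> rcases f with K' | j
  · exact congrArg _ (Subtype.ext hp)
  · have h : j ∈ Slot.preceding (T := T) (Sum.inl K) := hp.symm
    rw [hl] at h
    exact absurd h (T.before_irrefl j)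
  · have h : i ∈ Slot.preceding (T := T) (Sum.inl K') := hp
    rw [← hl] at h
    exact absurd h (T.before_irrefl i)
  · by_contra hij
    rcases T.before_total i j hp fun h => hij (h ▸ rfl) with h | h
    · have h : i ∈ Slot.preceding (T := T) (Sum.inr j) := h
      rw [← hl] at h
      exact T.before_irrefl i h
    · have h : j ∈ Slot.preceding (T := T) (Sum.inr i) := h
      rw [hl] at h
      exact T.before_irrefl j h

theorem insertAt_injective :
    Function.Injective fun p : Σ T : OrderedIncreasingKTree k n, T.Slot => p.1.insertAt p.2 := by
  rintro ⟨T, e⟩ ⟨T', e'⟩ h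
  have hT : T = T' := by
    rw [← T.removeLast_insertAt e, ← T'.removeLast_insertAt e']
    exact congrArg removeLast h
  subst hT
  have h : T.insertAt e = T.insertAt e' := h
  congr 1
  refine Slot.ext ?_ ?_
  · have h1 : parents (T.insertAt e).graph (Fin.last n) =
        parents (T.insertAt e').graph (Fin.last n) := by
      rw [h]
    rwa [insertAt_graph, insertAt_graph, parents_addNode_last, parents_addNode_last,
      old_injective.image_injective.eq_iff] at h1
  · ext i
    rw [← insertAt_before_castSucc_last, h, insertAt_before_castSucc_last]

/-- Every tree of size `n + 1` arises by insertion: the slot of the last node is given by the next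
one among its siblings, if there is one, and otherwise by the clique of its parents. -/
theorem insertAt_surjective :
    Function.Surjective fun p : Σ T : OrderedIncreasingKTree k n, T.Slot => p.1.insertAt p.2 := by
  intro T'
  let T := T'.removeLast
  have himg := parents_last_eq_image_old T'.graph
  obtain ⟨K, hK⟩ : ∃ K, K = old ⁻¹' parents T'.graph (Fin.last n) := ⟨_, rfl⟩
  rw [← hK] at himg
  have hKc : T.graph.IsClique K ∧ K.ncard = k := by
    refine ⟨fun a ha b hb hab => ?_, ?_⟩
    · rw [hK] at ha hb
      exact T'.parents_clique _ ha hb (old_injective.ne hab)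
    · have := T'.parents_card (Fin.last n)
      rwa [himg, Set.ncard_image_of_injective _ old_injective] at this
  have hpar : ∀ j : Fin n, parents T'.graph j.castSucc = old '' parents T.graph j :=
    parents_eq_image_old T'.graph
  have hsib : ∀ j : Fin n, parents T'.graph j.castSucc = parents T'.graph (Fin.last n) ↔
      parents T.graph j = K := by
    intro j
    rw [hpar, himg, old_injective.image_injective.eq_iff]
  -- it suffices to find a slot with the right parents and the right preceding nodes
  suffices h : ∃ e : T.Slot, e.parents = K ∧
      ∀ i : Fin n, i ∈ e.preceding ↔ T'.before i.castSucc (Fin.last n) by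
    obtain ⟨e, he, hpre⟩ := h
    refine ⟨⟨T, e⟩, ?_⟩
    ext a b
    · change (addNode T.graph e.parents).Adj a b ↔ _
      rw [he]
      have hnew : ∀ c, T'.graph.Adj new (old c) ↔ c ∈ K := by
        intro c
        have := label_le c
        rw [hK]
        simp [parents]
        omega
      rcases old_or_new a with ⟨a, rfl⟩ | rfl <;> rcases old_or_new b with ⟨b, rfl⟩ | rfl
      · rw [addNode_adj_old_old]
        rfl
      · rw [addNode_adj_old_new, T'.graph.adj_comm, hnew]
      · rw [addNode_adj_new_old, hnew]
      · simp
    · change (T.insertAt e).before a b ↔ _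
      induction a using Fin.lastCases with
      | last =>
        induction b using Fin.lastCases with
        | last => exact iff_of_false (before_irrefl _ _) (before_irrefl _ _)
        | cast j =>
          rw [insertAt_before_last_castSucc, hpre, he, ← hsib]
          constructor
          · rintro ⟨h1, h2⟩
            exact (T'.before_total _ _ h1 (Fin.castSucc_ne_last j)).resolve_left h2
          · intro h
            exact ⟨(T'.before_siblings _ _ h).symm,
              fun h' => T'.before_irrefl _ (T'.before_trans _ _ _ h h')⟩
      | cast i =>
        induction b using Fin.lastCases with
        | last => rw [insertAt_before_castSucc_last, hpre]
        | cast j =>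
          rw [insertAt_before_castSucc_castSucc]
          rfl
  by_cases hex : ∃ j : Fin n, T'.before (Fin.last n) j.castSucc
  · -- the first of the later siblings
    have : IsTrans (Fin n) T.before := ⟨T.before_trans⟩
    have : Std.Irrefl T.before := ⟨T.before_irrefl⟩
    obtain ⟨j, hj, hmin⟩ := (Finite.wellFounded_of_trans_of_irrefl T.before).has_min
      {j : Fin n | T'.before (Fin.last n) j.castSucc} hex
    refine ⟨Sum.inr j, (hsib j).1 (T'.before_siblings _ _ hj).symm, fun i => ?_⟩
    change T'.before i.castSucc j.castSucc ↔ _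
    constructor
    · intro h
      have hs := (T'.before_siblings _ _ h).trans (T'.before_siblings _ _ hj).symm
      refine (T'.before_total _ _ hs (Fin.castSucc_ne_last i)).resolve_right fun h' => ?_
      exact hmin i h' h
    · exact fun h => T'.before_trans _ _ _ h hj
  · push Not at hex
    refine ⟨Sum.inl ⟨K, hKc⟩, rfl, fun i => ?_⟩
    change parents T.graph i = K ↔ _
    rw [← hsib]
    constructor
    · intro h
      exact (T'.before_total _ _ h (Fin.castSucc_ne_last i)).resolve_right (hex i)
    · exact T'.before_siblings _ _

theorem sum_insertAt {M : Type*} [AddCommMonoid M] (f : OrderedIncreasingKTree k (n + 1) → M) :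
    ∑ T, f T = ∑ T : OrderedIncreasingKTree k n, ∑ e : T.Slot, f (T.insertAt e) := by
  rw [← Function.Bijective.sum_comp ⟨insertAt_injective, insertAt_surjective⟩ f,
    Fintype.sum_sigma]

end OrderedIncreasingKTree

/-! ### Counting cliques -/

namespace OrderedIncreasingKTree

open KTreeNode

variable {k n : ℕ}

theorem ncard_range_inl : (Set.range (Sum.inl : Fin k → KTreeNode k n)).ncard = k := by
  rw [← Set.image_univ, Set.ncard_image_of_injective _ Sum.inl_injective, Set.ncard_univ,
    Nat.card_eq_fintype_card, Fintype.card_fin]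

theorem isClique_insert_parents (T : OrderedIncreasingKTree k n) (j : Fin n) :
    T.graph.IsClique (insert (Sum.inr j) (parents T.graph j)) := by
  rw [SimpleGraph.isClique_insert]
  exact ⟨T.parents_clique j, fun b hb _ => hb.1⟩

/-- The `k`-cliques in terms of their last nodes: the root clique, and for each inserted node `j`
the sets obtained from `j` and its parents by leaving out one of the parents. -/
def cliqueOf (T : OrderedIncreasingKTree k n) :
    Option (Σ j : Fin n, parents T.graph j) → T.Clique
  | none => ⟨Set.range Sum.inl, by
      rintro _ ⟨a, rfl⟩ _ ⟨b, rfl⟩ hab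
      exact T.root_clique a b fun e => hab (e ▸ rfl), ncard_range_inl⟩
  | some ⟨j, p⟩ => ⟨insert (Sum.inr j) (parents T.graph j) \ {p.1},
      (T.isClique_insert_parents j).subset Set.sdiff_subset, by
      rw [Set.ncard_sdiff_singleton_of_mem (Set.mem_insert_of_mem _ p.2),
        Set.ncard_insert_of_notMem (not_mem_parents_self _ j), T.parents_card,
        Nat.add_sub_cancel]⟩

theorem inr_mem_cliqueOf_some (T : OrderedIncreasingKTree k n) (u j : Fin n)
    (p : parents T.graph j) : Sum.inr u ∈ (T.cliqueOf (some ⟨j, p⟩)).1 ↔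
      u = j ∨ (Sum.inr u ∈ parents T.graph j ∧ Sum.inr u ≠ p.1) := by
  change _ ∈ insert _ _ \ _ ↔ _
  rw [Set.mem_sdiff, Set.mem_insert_iff, Set.mem_singleton_iff, Sum.inr.injEq]
  constructor
  · rintro ⟨h | h, h'⟩
    · exact Or.inl h
    · exact Or.inr ⟨h, h'⟩
  · rintro (rfl | ⟨h, h'⟩)
    · exact ⟨Or.inl rfl, fun h => not_mem_parents_self _ u (h ▸ p.2)⟩
    · exact ⟨Or.inr h, h'⟩

theorem cliqueOf_injective (T : OrderedIncreasingKTree k n) : Function.Injective T.cliqueOf := by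
  have hlt : ∀ (u j : Fin n) (p : parents T.graph j),
      Sum.inr u ∈ (T.cliqueOf (some ⟨j, p⟩)).1 → u ≤ j := by
    intro u j p h
    rw [inr_mem_cliqueOf_some] at h
    rcases h with rfl | h
    · exact le_rfl
    · have : (u : ℕ) + 1 < j + 1 := h.1.2
      exact Fin.le_def.2 (by omega)
  have hself : ∀ (j : Fin n) (p : parents T.graph j),
      Sum.inr j ∈ (T.cliqueOf (some ⟨j, p⟩)).1 := fun j p =>
    (inr_mem_cliqueOf_some T j j p).2 (Or.inl rfl)
  have hnone : ∀ u : Fin n, Sum.inr u ∉ (T.cliqueOf none).1 := by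
    rintro u ⟨a, ha⟩
    exact Sum.inl_ne_inr ha
  rintro (_ | ⟨j, p⟩) (_ | ⟨j', p'⟩) h
  · rfl
  · exact absurd (h ▸ hself j' p') (hnone j')
  · exact absurd (h ▸ hself j p) (hnone j)
  · have hj : j = j' := le_antisymm (hlt j j' p' (h ▸ hself j p)) (hlt j' j p (h ▸ hself j' p'))
    subst hj
    have h : insert (Sum.inr j) (parents T.graph j) \ {p.1} =
      insert (Sum.inr j) (parents T.graph j) \ {p'.1} := congrArg Subtype.val h
    have hp : p = p' := by
      by_contra hpp
      have : p.1 ∈ insert (Sum.inr j) (parents T.graph j) \ {p'.1} :=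
        ⟨Set.mem_insert_of_mem _ p.2, fun e => hpp (Subtype.ext e)⟩
      rw [← h] at this
      exact this.2 rfl
    rw [hp]

theorem cliqueOf_surjective (T : OrderedIncreasingKTree k n) : Function.Surjective T.cliqueOf := by
  classical
  rintro ⟨K, hK, hcard⟩
  by_cases hex : ∃ j : Fin n, Sum.inr j ∈ K
  · -- the last node of `K`
    obtain ⟨j, hj, hmax⟩ := (Finset.univ.filter fun j : Fin n => Sum.inr j ∈ K).exists_max_image id
      (by obtain ⟨j, hj⟩ := hex; exact ⟨j, by simpa using hj⟩)
    simp only [Finset.mem_filter_univ, id] at hj hmax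
    have hsub : K \ {Sum.inr j} ⊆ parents T.graph j := by
      rintro a ⟨ha, haj⟩
      refine ⟨hK hj ha (Ne.symm haj), ?_⟩
      rcases a with a | a
      · exact Nat.succ_pos _
      · have h1 := hmax a ha
        have h2 : a ≠ j := fun e => haj (e ▸ rfl)
        have h3 := Fin.lt_def.1 (lt_of_le_of_ne h1 h2)
        change (a : ℕ) + 1 < j + 1
        omega
    have hc1 : (K \ {Sum.inr j}).ncard + 1 = k := by
      rw [Set.ncard_sdiff_singleton_add_one hj, hcard]
    have hc2 : (parents T.graph j \ (K \ {Sum.inr j})).ncard = 1 := by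
      rw [Set.ncard_sdiff hsub, T.parents_card]
      omega
    obtain ⟨p, hp⟩ := Set.ncard_eq_one.1 hc2
    have hpm : p ∈ parents T.graph j \ (K \ {Sum.inr j}) := hp ▸ rfl
    have hpj : p ≠ Sum.inr j := fun e => not_mem_parents_self _ j (e ▸ hpm.1)
    refine ⟨some ⟨j, p, hpm.1⟩, Subtype.ext ?_⟩
    change insert (Sum.inr j) (parents T.graph j) \ {p} = K
    ext a
    constructor
    · rintro ⟨rfl | ha, hap⟩
      · exact hj
      · by_contra haK
        have : a ∈ parents T.graph j \ (K \ {Sum.inr j}) := ⟨ha, fun h => haK h.1⟩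
        rw [hp] at this
        exact hap this
    · intro ha
      by_cases haj : a = Sum.inr j
      · exact ⟨Or.inl haj, fun h => hpj (h.symm.trans haj)⟩
      · exact ⟨Or.inr (hsub ⟨ha, haj⟩), fun h => hpm.2 (h ▸ ⟨ha, haj⟩)⟩
  · refine ⟨none, Subtype.ext ?_⟩
    change Set.range Sum.inl = K
    refine (Set.eq_of_subset_of_ncard_le ?_ ?_).symm
    · intro a ha
      rcases a with a | a
      · exact ⟨a, rfl⟩
      · exact absurd ⟨a, ha⟩ hex
    · rw [ncard_range_inl, hcard]

theorem sum_clique (T : OrderedIncreasingKTree k n) {M : Type*} [AddCommMonoid M]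
    [∀ j, Fintype (parents T.graph j)] (f : T.Clique → M) :
    ∑ K, f K = f (T.cliqueOf none) + ∑ j, ∑ p, f (T.cliqueOf (some ⟨j, p⟩)) := by
  rw [← Function.Bijective.sum_comp ⟨T.cliqueOf_injective, T.cliqueOf_surjective⟩ f,
    Fintype.sum_option, Fintype.sum_sigma]

/-- The number of nodes of which the inserted node `u` is a parent. -/
noncomputable def childCount (T : OrderedIncreasingKTree k n) (u : Fin n) : ℕ :=
  {j : Fin n | Sum.inr u ∈ parents T.graph j}.ncard

open Classical in
theorem childCount_eq_sum (T : OrderedIncreasingKTree k n) (u : Fin n) :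
    (T.childCount u : ℝ) = ∑ j : Fin n, if Sum.inr u ∈ parents T.graph j then 1 else 0 := by
  rw [childCount, Finset.sum_boole, Set.ncard_eq_toFinset_card']
  simp

theorem card_parents (T : OrderedIncreasingKTree k n) (j : Fin n)
    [Fintype (parents T.graph j)] : Fintype.card (parents T.graph j) = k := by
  rw [← Nat.card_eq_fintype_card, Nat.card_coe_set_eq, T.parents_card]

theorem card_slot (T : OrderedIncreasingKTree k n) :
    (Fintype.card T.Slot : ℝ) = (k + 1) * n + 1 := by
  classical
  rw [Fintype.card_sum, Fintype.card_fin, ← Finset.card_univ, Finset.card_eq_sum_ones,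
    sum_clique]
  simp only [Finset.sum_const, Finset.card_univ, card_parents]
  simp
  ring

open Classical in
/-- An inserted node `u` lies in `k + (k - 1) m` cliques of size `k`, where `m` is the number of
nodes of which it is a parent. Together with the slots directly before the latter nodes, this makes
`k (m + 1)` slots at which a new node becomes adjacent to `u`. -/
theorem sum_slot_mem_parents (T : OrderedIncreasingKTree k n) (u : Fin n) :
    (∑ e : T.Slot, if Sum.inr u ∈ e.parents then (1 : ℝ) else 0) = k * (T.childCount u + 1) := by
  have h0 : Sum.inr u ∉ (T.cliqueOf none).1 := by
    rintro ⟨a, ha⟩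
    exact Sum.inl_ne_inr ha
  have hone : ∀ j : Fin n, ∑ _p : parents T.graph j, (1 : ℝ) = k := by
    intro j
    rw [Finset.sum_const, Finset.card_univ, card_parents, nsmul_eq_mul, mul_one]
  have h1 : ∀ j : Fin n, (∑ p : parents T.graph j,
      if Sum.inr u ∈ (T.cliqueOf (some ⟨j, p⟩)).1 then (1 : ℝ) else 0) =
      (if u = j then (k : ℝ) else 0) +
        (k - 1) * (if Sum.inr u ∈ parents T.graph j then 1 else 0) := by
    intro j
    simp_rw [inr_mem_cliqueOf_some]
    by_cases huj : u = j
    · subst huj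
      simp only [true_or, if_true, not_mem_parents_self, if_false, mul_zero, add_zero, hone]
    · by_cases hmem : Sum.inr u ∈ parents T.graph j
      · have : ∀ p : parents T.graph j, (if u = j ∨ (Sum.inr u ∈ parents T.graph j ∧
            (Sum.inr u : KTreeNode k n) ≠ p.1) then (1 : ℝ) else 0) =
            1 - if (⟨Sum.inr u, hmem⟩ : parents T.graph j) = p then 1 else 0 := by
          intro p
          by_cases hp : (Sum.inr u : KTreeNode k n) = p.1
          · simp [huj, hp]
          · have hp' : (⟨Sum.inr u, hmem⟩ : parents T.graph j) ≠ p := fun e => hp (e ▸ rfl)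
            simp [huj, hmem, hp, hp']
        simp_rw [this]
        rw [Finset.sum_sub_distrib, hone, Finset.sum_ite_eq, if_pos (Finset.mem_univ _), if_neg huj,
          if_pos hmem]
        ring
      · simp [huj, hmem]
  rw [Fintype.sum_sum_type]
  change (∑ K : T.Clique, if Sum.inr u ∈ K.1 then (1 : ℝ) else 0) +
    (∑ j : Fin n, if Sum.inr u ∈ parents T.graph j then (1 : ℝ) else 0) = _
  rw [← childCount_eq_sum, sum_clique]
  simp_rw [h1, if_neg h0]
  rw [Finset.sum_add_distrib, ← Finset.mul_sum, ← childCount_eq_sum]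
  simp
  ring

theorem childCount_insertAt_last (T : OrderedIncreasingKTree k n) (e : T.Slot) :
    (T.insertAt e).childCount (Fin.last n) = 0 := by
  rw [childCount, Set.ncard_eq_zero]
  ext j
  rw [insertAt_graph]
  induction j using Fin.lastCases with
  | last => simp [parents_addNode_last, -Sum.exists]
  | cast j => simp [parents_addNode_castSucc, -Sum.exists]

open Classical in
theorem childCount_insertAt_castSucc (T : OrderedIncreasingKTree k n) (e : T.Slot) (u : Fin n) :
    (T.insertAt e).childCount u.castSucc =
      T.childCount u + if Sum.inr u ∈ e.parents then 1 else 0 := by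
  have h := childCount_eq_sum (T.insertAt e) u.castSucc
  rw [Fin.sum_univ_castSucc] at h
  simp only [insertAt_graph, parents_addNode_last, parents_addNode_castSucc, inr_castSucc,
    old_injective.mem_set_image] at h
  rw [← childCount_eq_sum] at h
  exact_mod_cast h

open Classical in
/-- One step of the growth process: summed over the slots, the new node contributes `f 0`, and a
node which is a parent of `m` nodes becomes a parent of one more at `k (m + 1)` slots. -/
theorem sum_slot_sum_childCount (T : OrderedIncreasingKTree k n) (f : ℕ → ℝ) :
    ∑ e : T.Slot, ∑ u : Fin (n + 1), f ((T.insertAt e).childCount u) =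
      ((k + 1) * n + 1) * (f 0 + ∑ u : Fin n, f (T.childCount u)) -
        k * ∑ u : Fin n, ((T.childCount u : ℝ) + 1) *
          (f (T.childCount u) - f (T.childCount u + 1)) := by
  have h : ∀ (e : T.Slot) (u : Fin n), f ((T.insertAt e).childCount u.castSucc) =
      f (T.childCount u) - (if Sum.inr u ∈ e.parents then (1 : ℝ) else 0) *
        (f (T.childCount u) - f (T.childCount u + 1)) := by
    intro e u
    rw [childCount_insertAt_castSucc]
    split_ifs <;> simp
  simp_rw [Fin.sum_univ_castSucc, childCount_insertAt_last, h]
  rw [Finset.sum_add_distrib, Finset.sum_comm]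
  simp_rw [Finset.sum_sub_distrib, ← Finset.sum_mul, sum_slot_mem_parents]
  simp only [Finset.sum_const, Finset.card_univ, nsmul_eq_mul, card_slot]
  rw [← Finset.mul_sum, Finset.mul_sum _ _ (k : ℝ)]
  simp only [mul_assoc]
  ring

end OrderedIncreasingKTree

/-! ### Local clustering coefficients -/

theorem ncard_sym2_not_isDiag {V : Type*} [Finite V] (S : Set V) :
    {e : Sym2 V | ¬ e.IsDiag ∧ ∀ v ∈ e, v ∈ S}.ncard = S.ncard.choose 2 := by
  classical
  have := Fintype.ofFinite V
  have h : {e : Sym2 V | ¬ e.IsDiag ∧ ∀ v ∈ e, v ∈ S} =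
      ((S.toFinset.offDiag.image fun p : V × V => s(p.1, p.2) : Finset (Sym2 V)) :
        Set (Sym2 V)) := by
    ext e
    induction e using Sym2.ind with
    | _ a b =>
      simp only [Set.mem_ofPred_eq, Sym2.mk_isDiag_iff, Sym2.mem_iff, forall_eq_or_imp, forall_eq,
        Finset.coe_image, Set.mem_image, Finset.mem_coe, Finset.mem_offDiag, Set.mem_toFinset,
        Prod.exists]
      constructor
      · rintro ⟨h, ha, hb⟩
        exact ⟨a, b, ⟨ha, hb, h⟩, rfl⟩
      · rintro ⟨x, y, ⟨hx, hy, h⟩, e⟩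
        rcases Sym2.eq_iff.1 e with ⟨rfl, rfl⟩ | ⟨rfl, rfl⟩
        · exact ⟨h, hx, hy⟩
        · exact ⟨Ne.symm h, hy, hx⟩
  rw [h, Set.ncard_coe_finset, Set.ncard_eq_toFinset_card']
  exact Sym2.card_image_offDiag _

theorem localClusteringCoeff_nonneg {V : Type*} (G : SimpleGraph V) (u : V) :
    0 ≤ localClusteringCoeff G u := by
  unfold localClusteringCoeff
  split_ifs <;> positivity

theorem localClusteringCoeff_le_one {V : Type*} [Finite V] (G : SimpleGraph V) (u : V) :
    localClusteringCoeff G u ≤ 1 := by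
  unfold localClusteringCoeff
  split_ifs
  · refine div_le_one_of_le₀ ?_ (Nat.cast_nonneg _)
    rw [← ncard_sym2_not_isDiag, Nat.cast_le]
    exact Set.ncard_le_ncard fun e he => ⟨G.not_isDiag_of_mem_edgeSet he.1, he.2⟩
  · exact zero_le_one

namespace OrderedIncreasingKTree

open KTreeNode

variable {k n : ℕ}

theorem neighborSet_inr (T : OrderedIncreasingKTree k n) (u : Fin n) :
    T.graph.neighborSet (Sum.inr u) =
      parents T.graph u ∪ Sum.inr '' {j : Fin n | Sum.inr u ∈ parents T.graph j} := by
  ext a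
  constructor
  · intro h
    have h : T.graph.Adj (Sum.inr u) a := h
    rcases a with a | j
    · exact Or.inl ⟨h, Nat.succ_pos _⟩
    · rcases lt_trichotomy j u with hju | rfl | hju
      · exact Or.inl ⟨h, Nat.succ_lt_succ hju⟩
      · exact absurd rfl h.ne
      · exact Or.inr ⟨j, ⟨h.symm, Nat.succ_lt_succ hju⟩, rfl⟩
  · rintro (h | ⟨j, hj, rfl⟩)
    · exact h.1
    · exact hj.1.symm

theorem ncard_neighborSet_inr (T : OrderedIncreasingKTree k n) (u : Fin n) :
    (T.graph.neighborSet (Sum.inr u)).ncard = k + T.childCount u := by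
  rw [neighborSet_inr, Set.ncard_union_eq, T.parents_card,
    Set.ncard_image_of_injective _ Sum.inr_injective, childCount]
  rw [Set.disjoint_left]
  rintro _ ha ⟨j, hj, rfl⟩
  exact lt_asymm ha.2 hj.2

/-- The edges between neighbours of an inserted node `u`: the parents of `u` form a clique, and each
node `j` with parent `u` is adjacent to the other `k - 1` parents of `j`, all of them neighbours of
`u`. -/
theorem ncard_edges_neighborSet_inr (T : OrderedIncreasingKTree k n) (u : Fin n) :
    {e ∈ T.graph.edgeSet | ∀ v ∈ e, v ∈ T.graph.neighborSet (Sum.inr u)}.ncard =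
      k.choose 2 + T.childCount u * (k - 1) := by
  classical
  let C : Finset (Fin n) := {j : Fin n | Sum.inr u ∈ parents T.graph j}.toFinset
  let P : Finset (Σ _ : Fin n, KTreeNode k n) :=
    C.sigma fun j => (parents T.graph j \ {Sum.inr u}).toFinset
  let f : (Σ _ : Fin n, KTreeNode k n) → Sym2 (KTreeNode k n) := fun p => s(Sum.inr p.1, p.2)
  have hP : ∀ (j : Fin n) (a : KTreeNode k n), ⟨j, a⟩ ∈ P ↔ Sum.inr u ∈ parents T.graph j ∧
      a ∈ parents T.graph j ∧ a ≠ Sum.inr u := by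
    intro j a
    simp [P, C]
  have hf : Set.InjOn f P := by
    rintro ⟨i, a⟩ hi ⟨j, b⟩ hj h
    rw [Finset.mem_coe, hP] at hi hj
    rcases Sym2.eq_iff.1 h with ⟨h1, h2⟩ | ⟨h1, h2⟩
    · have h1 : i = j := Sum.inr_injective h1
      have h2 : a = b := h2
      rw [h1, h2]
    · have h1 : Sum.inr i = b := h1
      have h2 : a = Sum.inr j := h2
      have h3 := hi.2.1.2
      have h4 := hj.2.1.2
      rw [← h1] at h4
      rw [h2] at h3
      exact absurd h3 (lt_asymm h4)
  have hcardP : P.card = T.childCount u * (k - 1) := by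
    rw [Finset.card_sigma, childCount, Set.ncard_eq_toFinset_card', ← smul_eq_mul]
    refine Finset.sum_eq_card_nsmul fun j hj => ?_
    have hj : Sum.inr u ∈ parents T.graph j := by simpa [C] using hj
    rw [← Set.ncard_eq_toFinset_card', Set.ncard_sdiff_singleton_of_mem hj, T.parents_card]
  have hset : {e ∈ T.graph.edgeSet | ∀ v ∈ e, v ∈ T.graph.neighborSet (Sum.inr u)} =
      {e : Sym2 (KTreeNode k n) | ¬ e.IsDiag ∧ ∀ v ∈ e, v ∈ parents T.graph u} ∪
        ((P.image f : Finset _) : Set (Sym2 (KTreeNode k n))) := by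
    -- an edge with an end `j` of which `u` is a parent
    have key : ∀ (j : Fin n) (b : KTreeNode k n), Sum.inr u ∈ parents T.graph j →
        T.graph.Adj (Sum.inr j) b → T.graph.Adj (Sum.inr u) b →
        ∃ p ∈ P, f p = s(Sum.inr j, b) := by
      intro j b hj hjb hub
      rcases lt_or_ge (label b) (label (Sum.inr j : KTreeNode k n)) with h | h
      · exact ⟨⟨j, b⟩, (hP j b).2 ⟨hj, ⟨hjb, h⟩, hub.ne'⟩, rfl⟩
      · rcases b with b | i
        · exact absurd h (by simp [label])
        · have hij : j ≠ i := fun e => hjb.ne (e ▸ rfl)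
          have h' : label (Sum.inr j : KTreeNode k n) < label (Sum.inr i : KTreeNode k n) :=
            lt_of_le_of_ne h fun e => hij (Fin.ext (Nat.succ_injective e))
          exact ⟨⟨i, Sum.inr j⟩, (hP i _).2 ⟨⟨hub.symm, hj.2.trans h'⟩, ⟨hjb.symm, h'⟩,
            hj.1.ne⟩, Sym2.eq_swap⟩
    ext e
    induction e using Sym2.ind with
    | _ a b =>
      simp only [Set.mem_ofPred_eq, Set.mem_union, SimpleGraph.mem_edgeSet, Sym2.mem_iff,
        forall_eq_or_imp, forall_eq, Sym2.mk_isDiag_iff, Finset.coe_image, Set.mem_image,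
        Finset.mem_coe]
      constructor
      · rintro ⟨hab, ha, hb⟩
        have ha' := ha
        have hb' := hb
        rw [neighborSet_inr] at ha' hb'
        rcases ha' with ha' | ⟨j, hj, rfl⟩
        · rcases hb' with hb' | ⟨j, hj, rfl⟩
          · exact Or.inl ⟨hab.ne, ha', hb'⟩
          · obtain ⟨p, hp, e⟩ := key j a hj hab.symm ha
            exact Or.inr ⟨p, hp, e.trans Sym2.eq_swap⟩
        · exact Or.inr (key j b hj hab hb)
      · rintro (⟨hab, ha, hb⟩ | ⟨⟨j, c⟩, hp, e⟩)
        · exact ⟨T.parents_clique u ha hb hab, ha.1, hb.1⟩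
        · rw [hP] at hp
          obtain ⟨h1, h2, h3⟩ := hp
          have h4 : T.graph.Adj (Sum.inr u) c := T.parents_clique j h1 h2 h3.symm
          rcases Sym2.eq_iff.1 e with ⟨rfl, rfl⟩ | ⟨rfl, rfl⟩
          · exact ⟨h2.1, h1.1.symm, h4⟩
          · exact ⟨h2.1.symm, h4, h1.1.symm⟩
  have hdisj : Disjoint {e : Sym2 (KTreeNode k n) | ¬ e.IsDiag ∧ ∀ v ∈ e, v ∈ parents T.graph u}
      ((P.image f : Finset _) : Set (Sym2 (KTreeNode k n))) := by
    rw [Set.disjoint_left]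
    rintro _ ⟨-, he⟩ hmem
    obtain ⟨⟨j, c⟩, hp, rfl⟩ := Finset.mem_image.1 (Finset.mem_coe.1 hmem)
    rw [hP] at hp
    exact lt_asymm (he (Sum.inr j) (Sym2.mem_mk_left _ _)).2 hp.1.2
  rw [hset, Set.ncard_union_eq hdisj, ncard_sym2_not_isDiag, T.parents_card, Set.ncard_coe_finset,
    Finset.card_image_of_injOn hf, hcardP]

theorem localClusteringCoeff_inr (hk : 2 ≤ k) (T : OrderedIncreasingKTree k n) (u : Fin n) :
    localClusteringCoeff T.graph (Sum.inr u) = nodeClustering k (T.childCount u) := by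
  have hk' : (2 : ℝ) ≤ k := by exact_mod_cast hk
  have hm : (0 : ℝ) ≤ T.childCount u := Nat.cast_nonneg _
  have h3 : (0 : ℝ) < k + T.childCount u - 1 := by linarith
  rw [localClusteringCoeff, ncard_neighborSet_inr, if_pos (by omega),
    ncard_edges_neighborSet_inr, nodeClustering]
  push_cast
  rw [Nat.cast_choose_two, Nat.cast_choose_two, Nat.cast_sub (by omega)]
  push_cast
  field_simp

end OrderedIncreasingKTree

/-! ### The limiting degree distribution -/

namespace OrderedIncreasingKTree

variable {k n : ℕ}

/-- The tree without inserted nodes. -/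
def rootTree (k : ℕ) : OrderedIncreasingKTree k 0 where
  graph := ⊤
  root_clique a b h := by simpa using h
  parents_clique j := j.elim0
  parents_card j := j.elim0
  before j := j.elim0
  before_siblings j := j.elim0
  before_irrefl j := j.elim0
  before_trans j := j.elim0
  before_total j := j.elim0

instance (k n : ℕ) : Nonempty (OrderedIncreasingKTree k n) := by
  induction n with
  | zero => exact ⟨rootTree k⟩
  | succ n ih =>
    obtain ⟨T⟩ := ih
    exact ⟨T.insertAt (Sum.inl (T.cliqueOf none))⟩

theorem card_succ (k n : ℕ) : (Fintype.card (OrderedIncreasingKTree k (n + 1)) : ℝ) =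
    ((k + 1) * n + 1) * Fintype.card (OrderedIncreasingKTree k n) := by
  have h := sum_insertAt (k := k) (n := n) (fun _ => (1 : ℝ))
  simp only [Finset.sum_const, Finset.card_univ, nsmul_eq_mul, mul_one, card_slot] at h
  rw [h]
  ring

/-- The expected value of `∑ u, f (m u)` for a uniformly random tree, where `u` ranges over the
inserted nodes and `m u` is the number of nodes of which `u` is a parent. -/
noncomputable def expectedNodeSum (k n : ℕ) (f : ℕ → ℝ) : ℝ :=
  (∑ T : OrderedIncreasingKTree k n, ∑ u : Fin n, f (T.childCount u)) /
    Fintype.card (OrderedIncreasingKTree k n)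

theorem expectedNodeSum_mono {f g : ℕ → ℝ} (h : ∀ m, f m ≤ g m) :
    expectedNodeSum k n f ≤ expectedNodeSum k n g := by
  unfold expectedNodeSum
  gcongr
  exact h _

theorem expectedNodeSum_const (c : ℝ) : expectedNodeSum k n (fun _ => c) = n * c := by
  have : (0 : ℝ) < Fintype.card (OrderedIncreasingKTree k n) := by exact_mod_cast Fintype.card_pos
  simp only [expectedNodeSum, Finset.sum_const, Finset.card_univ, nsmul_eq_mul, Fintype.card_fin]
  field_simp

theorem expectedNodeSum_add (f g : ℕ → ℝ) : expectedNodeSum k n (fun m => f m + g m) =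
    expectedNodeSum k n f + expectedNodeSum k n g := by
  simp only [expectedNodeSum, Finset.sum_add_distrib, add_div]

theorem expectedNodeSum_const_mul (c : ℝ) (f : ℕ → ℝ) :
    expectedNodeSum k n (fun m => c * f m) = c * expectedNodeSum k n f := by
  simp only [expectedNodeSum, ← Finset.mul_sum, mul_div_assoc]

theorem expectedNodeSum_sum {ι : Type*} (s : Finset ι) (f : ι → ℕ → ℝ) :
    expectedNodeSum k n (fun m => ∑ i ∈ s, f i m) = ∑ i ∈ s, expectedNodeSum k n (f i) := by
  classical
  induction s using Finset.induction_on with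
  | empty => simp [expectedNodeSum]
  | insert i s hi ih => simp only [Finset.sum_insert hi, expectedNodeSum_add, ih]

theorem expectedNodeSum_succ (f : ℕ → ℝ) :
    expectedNodeSum k (n + 1) f = f 0 + expectedNodeSum k n f -
      k / ((k + 1) * n + 1) * expectedNodeSum k n (fun m => ((m : ℝ) + 1) * (f m - f (m + 1))) := by
  have h1 : (0 : ℝ) < Fintype.card (OrderedIncreasingKTree k n) := by
    exact_mod_cast Fintype.card_pos
  have h2 : (0 : ℝ) < (k + 1) * n + 1 := by positivity
  rw [expectedNodeSum, card_succ, sum_insertAt]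
  simp_rw [sum_slot_sum_childCount]
  rw [Finset.sum_sub_distrib, ← Finset.mul_sum, ← Finset.mul_sum, Finset.sum_add_distrib,
    Finset.sum_const, Finset.card_univ, nsmul_eq_mul, expectedNodeSum, expectedNodeSum]
  field_simp

/-- The expected number of inserted nodes which are a parent of exactly `m` nodes. -/
noncomputable def expectedCount (k n m : ℕ) : ℝ :=
  expectedNodeSum k n fun j => if j = m then 1 else 0

theorem expectedCount_succ_zero : expectedCount k (n + 1) 0 =
    (1 - k / ((k + 1) * n + 1)) * expectedCount k n 0 + 1 := by
  rw [expectedCount, expectedNodeSum_succ]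
  have : (fun m : ℕ => ((m : ℝ) + 1) *
      ((if m = 0 then (1 : ℝ) else 0) - if m + 1 = 0 then 1 else 0)) =
      fun m => if m = 0 then 1 else 0 := by
    funext m
    rcases m with _ | m <;> simp
  rw [this, expectedCount]
  simp
  ring

theorem expectedCount_succ_succ (m : ℕ) : expectedCount k (n + 1) (m + 1) =
    (1 - k * (m + 2) / ((k + 1) * n + 1)) * expectedCount k n (m + 1) +
      k * (m + 1) / ((k + 1) * n + 1) * expectedCount k n m := by
  rw [expectedCount, expectedNodeSum_succ]
  have : (fun j : ℕ => ((j : ℝ) + 1) *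
      ((if j = m + 1 then (1 : ℝ) else 0) - if j + 1 = m + 1 then 1 else 0)) =
      fun j => ((m : ℝ) + 2) * (if j = m + 1 then 1 else 0) +
        (-((m : ℝ) + 1)) * (if j = m then 1 else 0) := by
    funext j
    by_cases h1 : j = m + 1
    · subst h1
      simp
      ring
    · by_cases h2 : j = m
      · subst h2
        simp
      · simp [h1, h2]
  rw [this, expectedNodeSum_add, expectedNodeSum_const_mul, expectedNodeSum_const_mul,
    expectedCount, expectedCount]
  simp
  ring

end OrderedIncreasingKTree

theorem tendsto_natCast_div_mul_add_one {c : ℝ} (hc : 0 < c) :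
    Tendsto (fun n : ℕ => (n : ℝ) / (c * n + 1)) atTop (𝓝 (1 / c)) := by
  have h : Tendsto (fun n : ℕ => 1 / (c + 1 / (n : ℝ))) atTop (𝓝 (1 / (c + 0))) :=
    tendsto_const_nhds.div (tendsto_one_div_atTop_nhds_zero_nat.const_add c) (by simpa using hc.ne')
  rw [add_zero] at h
  refine h.congr' ?_
  filter_upwards [eventually_gt_atTop 0] with n hn
  have : (0 : ℝ) < n := by exact_mod_cast hn
  field_simp

/-- A perturbed linear recurrence `x (n + 1) = (1 - b / (c n + 1)) x n + y n` with `y n → y` has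
`x n / n → y / (1 + b / c)`: the distance `|x n - n L|` to the linear solution grows by increments
that tend to zero. -/
theorem tendsto_div_of_linear_recurrence {x y : ℕ → ℝ} {b c l : ℝ} (hb : 0 ≤ b) (hc : 0 < c)
    (hx : ∀ n : ℕ, x (n + 1) = (1 - b / (c * n + 1)) * x n + y n)
    (hy : Tendsto y atTop (𝓝 l)) :
    Tendsto (fun n : ℕ => x n / n) atTop (𝓝 (l / (1 + b / c))) := by
  obtain ⟨L, hL⟩ : ∃ L, L = l / (1 + b / c) := ⟨_, rfl⟩
  have hbc : 0 < 1 + b / c := by positivity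
  have hlL : l = L + b / c * L := by rw [hL]; field_simp
  rw [← hL]
  let ε : ℕ → ℝ := fun n => |y n - L - b * L * (n / (c * n + 1))|
  have hε : Tendsto ε atTop (𝓝 0) := by
    have h := ((hy.sub_const L).sub ((tendsto_natCast_div_mul_add_one hc).const_mul (b * L))).abs
    have h0 : l - L - b * L * (1 / c) = 0 := by rw [hlL]; ring
    rwa [h0, abs_zero] at h
  let d : ℕ → ℝ := fun n => |x n - n * L|
  obtain ⟨n₀, hn₀⟩ := exists_nat_ge (b / c)
  have hd : ∀ n ≥ n₀, d (n + 1) ≤ d n + ε n := by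
    intro n hn
    have hn' : b ≤ c * n + 1 := by
      have h1 : b / c ≤ n := hn₀.trans (by exact_mod_cast hn)
      rw [div_le_iff₀ hc] at h1
      linarith
    have hpos : 0 < c * n + 1 := by positivity
    have h1 : |1 - b / (c * n + 1)| ≤ 1 := by
      rw [abs_le]
      have h2 : b / (c * n + 1) ≤ 1 := (div_le_one hpos).2 hn'
      have h3 : 0 ≤ b / (c * n + 1) := by positivity
      constructor <;> linarith
    have h2 : x (n + 1) - (n + 1 : ℕ) * L = (1 - b / (c * n + 1)) * (x n - n * L) +
        (y n - L - b * L * (n / (c * n + 1))) := by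
      rw [hx]
      push_cast
      field_simp
      ring
    calc d (n + 1) ≤ |1 - b / (c * n + 1)| * d n + ε n := by
          change |x (n + 1) - (n + 1 : ℕ) * L| ≤ _
          rw [h2, ← abs_mul]
          exact abs_add_le _ _
      _ ≤ 1 * d n + ε n := by
          gcongr
      _ = d n + ε n := by rw [one_mul]
  have hd' : ∀ n, d n ≤ (∑ i ∈ Finset.range n₀, d i + d n₀) + ∑ i ∈ Finset.range n, ε i := by
    intro n
    have hεn : ∀ n, 0 ≤ ∑ i ∈ Finset.range n, ε i := fun n =>
      Finset.sum_nonneg fun i _ => abs_nonneg _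
    have hdn : 0 ≤ ∑ i ∈ Finset.range n₀, d i := Finset.sum_nonneg fun i _ => abs_nonneg _
    rcases lt_or_ge n n₀ with h | h
    · have h1 := Finset.single_le_sum (f := d) (fun i _ => abs_nonneg _) (Finset.mem_range.2 h)
      have h2 : 0 ≤ d n₀ := abs_nonneg _
      linarith [hεn n]
    · induction n, h using Nat.le_induction with
      | base => linarith [hεn n₀]
      | succ n hn ih =>
        rw [Finset.sum_range_succ]
        linarith [hd n hn]
  have hlim : Tendsto (fun n : ℕ => (∑ i ∈ Finset.range n₀, d i + d n₀) / n +
      (n : ℝ)⁻¹ * ∑ i ∈ Finset.range n, ε i) atTop (𝓝 0) := by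
    simpa using (tendsto_const_div_atTop_nhds_zero_nat _).add hε.cesaro
  rw [tendsto_iff_norm_sub_tendsto_zero]
  refine squeeze_zero' (Eventually.of_forall fun n => norm_nonneg _) ?_ hlim
  filter_upwards [eventually_gt_atTop 0] with n hn
  have hn' : (0 : ℝ) < n := by exact_mod_cast hn
  have h1 : x n / n - L = (x n - n * L) / n := by field_simp
  rw [h1, norm_div, Real.norm_eq_abs, Real.norm_of_nonneg hn'.le, inv_mul_eq_div, ← add_div]
  exact div_le_div_of_nonneg_right (hd' n) hn'.le

namespace OrderedIncreasingKTree

variable {k : ℕ}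

theorem degreeLimit_zero (hk : 0 < k) : degreeLimit k 0 = 1 / (1 + (k : ℝ) / (k + 1)) := by
  have hk' : (0 : ℝ) < k := by exact_mod_cast hk
  rw [degreeLimit, betaTerm_zero]
  field_simp
  ring

theorem degreeLimit_succ (hk : 0 < k) (m : ℕ) : degreeLimit k (m + 1) =
    k * (m + 1) / (k + 1) * degreeLimit k m / (1 + k * (m + 2) / (k + 1)) := by
  have hk' : (0 : ℝ) < k := by exact_mod_cast hk
  have h := betaTerm_succ (by positivity : 0 < 2 + 1 / (k : ℝ)) m
  have h' : betaTerm (2 + 1 / (k : ℝ)) (m + 1) =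
      (m + 1) / (2 + 1 / (k : ℝ) + m + 1) * betaTerm (2 + 1 / (k : ℝ)) m := by
    have : (0 : ℝ) < 2 + 1 / (k : ℝ) + m + 1 := by positivity
    field_simp at h ⊢
    linarith
  rw [degreeLimit, degreeLimit, h']
  have : (0 : ℝ) < 2 + 1 / (k : ℝ) + m + 1 := by positivity
  field_simp
  ring

theorem tendsto_expectedCount_div (hk : 0 < k) (m : ℕ) :
    Tendsto (fun n : ℕ => expectedCount k n m / n) atTop (𝓝 (degreeLimit k m)) := by
  have hc : (0 : ℝ) < (k : ℝ) + 1 := by positivity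
  induction m with
  | zero =>
    rw [degreeLimit_zero hk]
    exact tendsto_div_of_linear_recurrence (Nat.cast_nonneg k) hc
      (fun n => expectedCount_succ_zero) tendsto_const_nhds
  | succ m ih =>
    rw [degreeLimit_succ hk]
    refine tendsto_div_of_linear_recurrence (by positivity) hc
      (fun n => expectedCount_succ_succ m) ?_
    have h := ((tendsto_natCast_div_mul_add_one hc).const_mul ((k : ℝ) * (m + 1))).mul ih
    rw [mul_one_div] at h
    refine h.congr' ?_
    filter_upwards [eventually_gt_atTop 0] with n hn
    have : (0 : ℝ) < n := by exact_mod_cast hn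
    field_simp

/-- Since the clustering coefficient of a node tends to zero with its degree, the convergence of
the proportion of nodes of each degree suffices for that of the mean clustering coefficient. -/
theorem tendsto_expectedNodeSum_nodeClustering (hk : 2 ≤ k) :
    Tendsto (fun n : ℕ => expectedNodeSum k n (nodeClustering k) / n) atTop
      (𝓝 (clusteringLimit k)) := by
  have happrox : ∀ M : ℕ, ∀ n : ℕ, |expectedNodeSum k n (nodeClustering k) / n -
      ∑ m ∈ Finset.range M, nodeClustering k m * (expectedCount k n m / n)| ≤
        2 * (k : ℝ) / (M + 1) := by
    intro M n
    let g : ℕ → ℝ := fun j => ∑ m ∈ Finset.range M, nodeClustering k m * if j = m then 1 else 0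
    have hg : ∀ j, g j = if j < M then nodeClustering k j else 0 := by
      intro j
      simp [g]
    have hgsum : expectedNodeSum k n g =
        ∑ m ∈ Finset.range M, nodeClustering k m * expectedCount k n m := by
      simp only [g, expectedNodeSum_sum, expectedNodeSum_const_mul, expectedCount]
    have h1 : expectedNodeSum k n g ≤ expectedNodeSum k n (nodeClustering k) := by
      refine expectedNodeSum_mono fun j => ?_
      rw [hg]
      split_ifs
      · exact le_rfl
      · exact nodeClustering_nonneg hk j
    have h2 : expectedNodeSum k n (nodeClustering k) ≤
        expectedNodeSum k n g + n * (2 * (k : ℝ) / (M + 1)) := by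
      rw [← expectedNodeSum_const, ← expectedNodeSum_add]
      refine expectedNodeSum_mono fun j => ?_
      rw [hg]
      split_ifs with h
      · have : 0 ≤ 2 * (k : ℝ) / (M + 1) := by positivity
        linarith
      · rw [zero_add]
        refine (nodeClustering_le hk j).trans ?_
        have : (M : ℝ) ≤ j := by exact_mod_cast not_lt.1 h
        gcongr
    simp_rw [mul_div_assoc']
    rw [← Finset.sum_div, ← hgsum, ← sub_div, abs_of_nonneg (by
      refine div_nonneg (sub_nonneg.2 h1) (Nat.cast_nonneg n))]
    refine div_le_of_le_mul₀ (Nat.cast_nonneg n) (by positivity) ?_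
    linarith
  have hpart : Tendsto (fun M : ℕ => ∑ m ∈ Finset.range M, clusteringTerm k m) atTop
      (𝓝 (clusteringLimit k)) := (summable_clusteringTerm hk).hasSum.tendsto_sum_nat
  have hbound : Tendsto (fun M : ℕ => 2 * (k : ℝ) / (M + 1)) atTop (𝓝 0) :=
    Tendsto.div_atTop tendsto_const_nhds
      (tendsto_atTop_add_const_right _ _ tendsto_natCast_atTop_atTop)
  rw [Metric.tendsto_atTop]
  intro ε hε
  obtain ⟨M, hM1, hM2⟩ := ((Metric.tendsto_nhds.1 hpart (ε / 3) (by positivity)).and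
    (hbound.eventually_lt_const (by positivity : 0 < ε / 3))).exists
  have hM : Tendsto (fun n : ℕ => ∑ m ∈ Finset.range M,
      nodeClustering k m * (expectedCount k n m / n)) atTop
      (𝓝 (∑ m ∈ Finset.range M, clusteringTerm k m)) := by
    refine tendsto_finsetSum _ fun m _ => ?_
    rw [clusteringTerm_eq hk, mul_comm]
    exact (tendsto_expectedCount_div (by omega) m).const_mul _
  obtain ⟨N, hN⟩ := Metric.tendsto_atTop.1 hM (ε / 3) (by positivity)
  refine ⟨N, fun n hn => ?_⟩
  have h1 := happrox M n
  rw [← Real.dist_eq] at h1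
  exact (dist_triangle4 _ _ _ _).trans_lt
    ((add_lt_add (add_lt_add (h1.trans_lt hM2) (hN n hn)) hM1).trans_eq (add_thirds ε))

theorem expectedClustering_eq (hk : 2 ≤ k) (n : ℕ) :
    expectedClustering k n = (expectedNodeSum k n (nodeClustering k) +
      (∑ T : OrderedIncreasingKTree k n, ∑ a : Fin k, localClusteringCoeff T.graph (Sum.inl a)) /
        Fintype.card (OrderedIncreasingKTree k n)) / (k + n) := by
  have h1 : (0 : ℝ) < Fintype.card (OrderedIncreasingKTree k n) := by
    exact_mod_cast Fintype.card_pos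
  have hk' : (0 : ℝ) < k := by exact_mod_cast (by omega : 0 < k)
  have hkn : (0 : ℝ) < (k : ℝ) + n := by positivity
  simp_rw [expectedClustering, Fintype.expect_eq_sum_div_card, Fintype.sum_sum_type,
    localClusteringCoeff_inr hk, Fintype.card_sum, Fintype.card_fin]
  rw [← Finset.sum_div, Finset.sum_add_distrib, expectedNodeSum]
  push_cast
  field_simp
  ring

theorem tendsto_expectedClustering (hk : 2 ≤ k) :
    Tendsto (fun n : ℕ => expectedClustering k n) atTop (𝓝 (clusteringLimit k)) := by
  let R : ℕ → ℝ := fun n => (∑ T : OrderedIncreasingKTree k n, ∑ a : Fin k,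
    localClusteringCoeff T.graph (Sum.inl a)) / Fintype.card (OrderedIncreasingKTree k n)
  have hR0 : ∀ n, 0 ≤ R n := fun n => div_nonneg (Finset.sum_nonneg fun T _ =>
    Finset.sum_nonneg fun a _ => localClusteringCoeff_nonneg _ _) (Nat.cast_nonneg _)
  have hR1 : ∀ n, R n ≤ k := by
    intro n
    refine div_le_of_le_mul₀ (Nat.cast_nonneg _) (Nat.cast_nonneg _) ?_
    calc _ ≤ ∑ T : OrderedIncreasingKTree k n, ∑ a : Fin k, (1 : ℝ) :=
          Finset.sum_le_sum fun T _ => Finset.sum_le_sum fun a _ => localClusteringCoeff_le_one _ _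
      _ = _ := by simp [mul_comm]
  have hRlim : Tendsto (fun n : ℕ => R n / n) atTop (𝓝 0) :=
    squeeze_zero (fun n => div_nonneg (hR0 n) (Nat.cast_nonneg n))
      (fun n => div_le_div_of_nonneg_right (hR1 n) (Nat.cast_nonneg n))
      (tendsto_const_div_atTop_nhds_zero_nat (k : ℝ))
  have hden : Tendsto (fun n : ℕ => (k : ℝ) / n + 1) atTop (𝓝 (0 + 1)) :=
    (tendsto_const_div_atTop_nhds_zero_nat (k : ℝ)).add_const 1
  have h := ((tendsto_expectedNodeSum_nodeClustering hk).add hRlim).div hden (by norm_num)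
  rw [add_zero, zero_add, div_one] at h
  refine h.congr' ?_
  filter_upwards [eventually_gt_atTop 0] with n hn
  have hn' : (0 : ℝ) < n := by exact_mod_cast hn
  rw [expectedClustering_eq hk]
  change (_ / _ + R n / _) / _ = (_ + R n) / _
  field_simp

end OrderedIncreasingKTree

theorem theorem4 :
    (∀ k : ℕ, 2 ≤ k →
      Summable (clusteringTerm k) ∧
      Tendsto (fun n : ℕ => expectedClustering k n) atTop (𝓝 (clusteringLimit k)) ∧
      clusteringLimit k = clusteringClosedForm k) ∧
    clusteringLimit 2 = 23 - 9 * Real.pi ^ 2 / 4 ∧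
    Tendsto (fun k : ℕ => clusteringLimit k) atTop (𝓝 1) := by
  exact ⟨fun _ hk => ⟨summable_clusteringTerm hk,
    OrderedIncreasingKTree.tendsto_expectedClustering hk, clusteringLimit_eq_closedForm hk⟩,
    clusteringLimit_two, tendsto_clusteringLimit⟩
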